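/- A \emph{game arena} consists of a finite directed graph $(V,E)$, $E\subseteq V\times V$, in which every vertex has a successor, and a partition of $V$ into the vertices of Eve and the vertices of Adam. A \emph{generalised reachability game} $G=(A,s,\mathcal F,T)$ consists of an arena $A$, a start vertex $s\in V$, a set $\mathcal F$ of subsets of $V$ with more than one element each, and a set $T\subseteq V$; its target sets are the members of $\mathcal F$ and the singletons $\{t\}$, $t\in T$. A strategy of a player assigns to every finite sequence of vertices ending in a vertex $v$ of that player a successor of $v$. Two strategies, one for each player, induce an infinite play from $s$, and Eve wins it if, after finitely many moves, it has visited every target set (in any order). The problem $\mathsf{GenReach}$ asks, given $G$, whether Eve has a strategy such that she wins against every strategy of Adam. \textbf{Theorem.} There are a program for a unit-cost random access machine (with addition, truncated subtraction and indirect addressing) and a constant $C$ such that, for every generalised reachability game $G=(A,s,\mathcal F,T)$ with $m=|E|$, $n=|T|$ and $k=|\mathcal F|$, given by the owners of its vertices and by lists, in any order, of its edges, its singleton targets and its non-singleton target sets, the program decides $\mathsf{GenReach}$ for $G$ in at most $C\cdot m\cdot\max(n,1)\cdot 2^k$ steps; that is, in time $O(m\,n\,2^k)$ for $n\ge 1$,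 and $O(m\,2^k)$ for $n=0$. In particular, $\mathsf{GenReach}$ is fixed-parameter tractable in the number $k$ of non-singleton target sets: there are a program, a computable function $f:\mathbb N\to\mathbb N$ and an exponent $d$ such that the program decides $\mathsf{GenReach}$ for every such $G$ in at most $f(k)\cdot |G|^d$ steps, where $|G|=|V|+|E|+|T|+\sum_{F\in\mathcal F}|F|$. -/

import Mathlib

namespace GenReach

/-! ### Games -/

inductive Player where
  | eve
  | adam
  deriving DecidableEq

/-- A game arena on the finite vertex set `V`: a finite directed graph and a partition of the
vertices between the two players, given by the owner of each vertex. Every vertex has a successor,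
so that a player can always move and plays are infinite. -/
structure Arena (V : Type*) where
  edges : Finset (V × V)
  owner : V → Player
  exists_succ : ∀ v, ∃ w, (v, w) ∈ edges

/-- A generalised reachability game: the target sets are the members of `sets`, each of which has
more than one element, and the singletons `{t}` for `t ∈ singles`. -/
structure Game (V : Type*) where
  arena : Arena V
  start : V
  sets : Finset (Finset V)
  one_lt_card : ∀ X ∈ sets, 1 < X.card
  singles : Finset V

/-- A strategy of player `p`, as a map `V* · V_p → V`: `move h v` is the move at the current vertex
`v` (owned by `p`) after the earlier part `h` of the history. -/
structure Strategy {V : Type*} (A : Arena V) (p : Player) where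
  move : List V → {v : V // A.owner v = p} → V
  legal : ∀ h v, (v.1, move h v) ∈ A.edges

/-- The vertex that follows the history `h · v`. -/
def Arena.next {V : Type*} (A : Arena V) (σ : Strategy A .eve) (τ : Strategy A .adam)
    (h : List V) (v : V) : V :=
  match hv : A.owner v with
  | .eve => σ.move h ⟨v, hv⟩
  | .adam => τ.move h ⟨v, hv⟩

/-- The situation after `i` moves: the list of the first `i` vertices, and the current vertex. -/
def Arena.playAux {V : Type*} (A : Arena V) (σ : Strategy A .eve) (τ : Strategy A .adam) (s : V) :
    ℕ → List V × V
  | 0 => ([], s)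
  | i + 1 =>
    let x := A.playAux σ τ s i
    (x.1 ++ [x.2], A.next σ τ x.1 x.2)

/-- The infinite play from `s` induced by a pair of strategies. -/
def Arena.play {V : Type*} (A : Arena V) (σ : Strategy A .eve) (τ : Strategy A .adam) (s : V)
    (i : ℕ) : V :=
  (A.playAux σ τ s i).2

/-- `X` is one of the target sets of the game. -/
def Game.IsTarget {V : Type*} (G : Game V) (X : Finset V) : Prop :=
  X ∈ G.sets ∨ ∃ t ∈ G.singles, X = {t}

/-- The finite play `π 0, …, π l` visits every target set. -/
def Game.WinningUpTo {V : Type*} (G : Game V) (π : ℕ → V) (l : ℕ) : Prop :=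
  ∀ X, G.IsTarget X → ∃ j ≤ l, π j ∈ X

/-- Eve has a strategy that, against every strategy of Adam, visits all target sets after finitely
many moves. -/
def Game.EveWins {V : Type*} (G : Game V) : Prop :=
  ∃ σ : Strategy G.arena .eve, ∀ τ : Strategy G.arena .adam,
    ∃ l, G.WinningUpTo (G.arena.play σ τ G.start) l

/-! ### Random access programs with unit cost -/

/-- The memory: registers and arrays, both numbered, with natural numbers as contents. A program
names its registers and its arrays explicitly, hence uses finitely many of them; the cells of an
array are addressed by computed values. -/
structure Mem where
  reg : ℕ → ℕ
  arr : ℕ → ℕ → ℕ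

/-- Expressions: constants, registers, array cells, addition, truncated subtraction. -/
inductive Expr where
  | const (c : ℕ)
  | reg (r : ℕ)
  | load (a : ℕ) (i : Expr)
  | add (x y : Expr)
  | sub (x y : Expr)

def Expr.eval (μ : Mem) : Expr → ℕ
  | .const c => c
  | .reg r => μ.reg r
  | .load a i => μ.arr a (i.eval μ)
  | .add x y => x.eval μ + y.eval μ
  | .sub x y => x.eval μ - y.eval μ

/-- The number of elementary operations in the evaluation of an expression. -/
def Expr.cost : Expr → ℕ
  | .const _ => 1
  | .reg _ => 1
  | .load _ i => i.cost + 1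
  | .add x y => x.cost + y.cost + 1
  | .sub x y => x.cost + y.cost + 1

/-- Programs. A test `x` counts as true if the value of `x` is not `0`. -/
inductive Prog where
  | skip
  | assign (r : ℕ) (x : Expr)
  | store (a : ℕ) (i x : Expr)
  | seq (p q : Prog)
  | cond (x : Expr) (p q : Prog)
  | loop (x : Expr) (p : Prog)

def Mem.setReg (μ : Mem) (r v : ℕ) : Mem :=
  { μ with reg := Function.update μ.reg r v }

def Mem.setArr (μ : Mem) (a i v : ℕ) : Mem :=
  { μ with arr := Function.update μ.arr a (Function.update (μ.arr a) i v) }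

/-- `Exec p μ t μ'`: started on the memory `μ`, the program `p` halts after exactly `t` steps with
the memory `μ'`. -/
inductive Exec : Prog → Mem → ℕ → Mem → Prop
  | skip (μ : Mem) : Exec .skip μ 1 μ
  | assign (μ : Mem) (r : ℕ) (x : Expr) :
      Exec (.assign r x) μ (x.cost + 1) (μ.setReg r (x.eval μ))
  | store (μ : Mem) (a : ℕ) (i x : Expr) :
      Exec (.store a i x) μ (i.cost + x.cost + 1) (μ.setArr a (i.eval μ) (x.eval μ))
  | seq {p q : Prog} {μ μ' μ'' : Mem} {t t' : ℕ} :
      Exec p μ t μ' → Exec q μ' t' μ'' → Exec (.seq p q) μ (t + t') μ''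
  | cond_true {x : Expr} {p q : Prog} {μ μ' : Mem} {t : ℕ} :
      x.eval μ ≠ 0 → Exec p μ t μ' → Exec (.cond x p q) μ (x.cost + 1 + t) μ'
  | cond_false {x : Expr} {p q : Prog} {μ μ' : Mem} {t : ℕ} :
      x.eval μ = 0 → Exec q μ t μ' → Exec (.cond x p q) μ (x.cost + 1 + t) μ'
  | loop_true {x : Expr} {p : Prog} {μ μ' μ'' : Mem} {t t' : ℕ} :
      x.eval μ ≠ 0 → Exec p μ t μ' → Exec (.loop x p) μ' t' μ'' →
      Exec (.loop x p) μ (x.cost + 1 + t + t') μ''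
  | loop_false {x : Expr} {p : Prog} {μ : Mem} :
      x.eval μ = 0 → Exec (.loop x p) μ (x.cost + 1) μ

/-! ### Games as inputs of programs -/

/-- A presentation of a game: a numbering of the vertices, and lists without repetitions, in any
order, of the edges, of the singleton targets, and of the non-singleton target sets, the latter
being themselves lists of vertices. -/
structure Presentation {V : Type*} [Fintype V] (G : Game V) where
  num : V ≃ Fin (Fintype.card V)
  edges : List (V × V)
  edges_eq : Multiset.ofList edges = G.arena.edges.val
  singles : List V
  singles_eq : Multiset.ofList singles = G.singles.val
  sets : List (List V)
  sets_eq : Multiset.ofList (sets.map Multiset.ofList) = G.sets.val.map Finset.val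

/-- The code of the owner of a vertex. -/
def Player.code : Player → ℕ
  | .eve => 0
  | .adam => 1

/-- The initial memory. Registers: `0` number of vertices, `1` number of edges, `2` number of
singleton targets, `3` number of non-singleton target sets, `4` start vertex. Arrays: `0` owners of
the vertices, `1` sources and `2` ends of the edges, `3` singleton targets, `4` sizes of the
non-singleton target sets, `5` their elements, one set after the other. All other cells are `0`. -/
def Presentation.input {V : Type*} [Fintype V] {G : Game V} (P : Presentation G) : Mem where
  reg r := [Fintype.card V, P.edges.length, P.singles.length, P.sets.length,
    (P.num G.start : ℕ)].getD r 0
  arr a i :=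
    match a with
    | 0 => if h : i < Fintype.card V then (G.arena.owner (P.num.symm ⟨i, h⟩)).code else 0
    | 1 => (P.edges.map fun e => (P.num e.1 : ℕ)).getD i 0
    | 2 => (P.edges.map fun e => (P.num e.2 : ℕ)).getD i 0
    | 3 => (P.singles.map fun v => (P.num v : ℕ)).getD i 0
    | 4 => (P.sets.map List.length).getD i 0
    | 5 => (P.sets.flatten.map fun v => (P.num v : ℕ)).getD i 0
    | _ => 0

/-- On every presentation of `G`, the program `p` halts after at most `t` steps, with output `1` in
register `0` if and only if Eve wins `G`. -/
def SolvesWithin {V : Type*} [Fintype V] (p : Prog) (G : Game V) (t : ℕ) : Prop :=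
  ∀ P : Presentation G, ∃ t' ≤ t, ∃ μ, Exec p P.input t' μ ∧ (μ.reg 0 = 1 ↔ G.EveWins)

/-- The size of a game: the total length of its lists. -/
def Game.size {V : Type*} [Fintype V] (G : Game V) : ℕ :=
  Fintype.card V + G.arena.edges.card + G.singles.card + ∑ X ∈ G.sets, X.card

end GenReach

/-! Remembering which singletons have been visited would cost a factor 2^n. The point is that a
counter with n + 1 levels is enough. Write t ≤ t' if Eve can force a visit to t' from t (`Game.le`).
This is a preorder, and if Eve wins it is total on T (`Game.Wins.total`): some continuation of a
winning position with t and t' unvisited reaches one of them first, and from there Eve, still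
winning, forces the other. The equivalence classes then form a chain; `height t` counts the
singletons in the classes up to that of t, and `lower t` those in the classes strictly below.

The monitor for T stores a level c, initially 0, and jumps to `height v` when a singleton v with
`lower v = c < height v` is left. Reaching level n suffices (`Game.MonitorWins.wins`): before a jump
at v, Eve inserts a tour through the class of v that returns to v, so that at least c singletons of
height at most c have really been visited; this needs no totality. It is also necessary
(`Game.Wins.monitorWins`): a winning play cannot skip a class, because from v Eve must still be able
to force every unvisited u, which gives v ≤ u and rules out u of smaller height. Each set of F gets
a monitor with two levels. So Eve wins if and only if, in the product of the arena with all
monitors, she can force all of them to their last levels (`Game.eveWins_iff_monitorWins`).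

Strategies are eliminated by `Game.eveWins_iff`: winning is membership in an attractor on pairs of a
vertex and the set of earlier vertices. Decreasing ranks yield a strategy for Eve, and the
complement of the attractor is a trap in which Adam can stay.

Attractors are computed in linear time with one counter per vertex and a queue (`AttrInv`). The
program computes n attractors in the arena to obtain the heights, builds the product one monitor at
a time, and computes one attractor in the product, which has m(n + 1)2^k edges. The intermediate
products double in size, so their construction costs a geometric sum; n ≤ |V| ≤ m absorbs the rest.
Product vertices are numbered in mixed radix (`code`), which makes the final targets an interval,
and `Attr.bisim_iff` carries attractors over to these numbers. -/

namespace GenReach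

/-! ### Running programs -/

/-- Started on `μ`, the program `p` halts after at most `B` steps with a memory that satisfies `Q`. -/
def Runs (p : Prog) (μ : Mem) (B : ℕ) (Q : Mem → Prop) : Prop :=
  ∃ t ≤ B, ∃ μ', Exec p μ t μ' ∧ Q μ'

@[simp] theorem Mem.setReg_reg (μ : Mem) (r v r' : ℕ) :
    (μ.setReg r v).reg r' = if r' = r then v else μ.reg r' := by
  simp [Mem.setReg, Function.update_apply]

@[simp] theorem Mem.setReg_arr (μ : Mem) (r v : ℕ) : (μ.setReg r v).arr = μ.arr := rfl

@[simp] theorem Mem.setArr_reg (μ : Mem) (a i v : ℕ) : (μ.setArr a i v).reg = μ.reg := rfl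

@[simp] theorem Mem.setArr_arr (μ : Mem) (a i v a' : ℕ) :
    (μ.setArr a i v).arr a' = if a' = a then Function.update (μ.arr a) i v else μ.arr a' := by
  simp [Mem.setArr, Function.update_apply]

/-- The registers that a program may change. -/
def Prog.regs : Prog → List ℕ
  | .skip => []
  | .assign r _ => [r]
  | .store _ _ _ => []
  | .seq p q => p.regs ++ q.regs
  | .cond _ p q => p.regs ++ q.regs
  | .loop _ p => p.regs

/-- The arrays that a program may change. -/
def Prog.arrs : Prog → List ℕ
  | .skip => []
  | .assign _ _ => []
  | .store a _ _ => [a]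
  | .seq p q => p.arrs ++ q.arrs
  | .cond _ p q => p.arrs ++ q.arrs
  | .loop _ p => p.arrs

/-- The memories agree outside of what `p` may change. -/
structure Same (p : Prog) (μ μ' : Mem) : Prop where
  reg : ∀ r, r ∉ p.regs → μ'.reg r = μ.reg r
  arr : ∀ a, a ∉ p.arrs → μ'.arr a = μ.arr a

theorem Same.refl (p : Prog) (μ : Mem) : Same p μ μ := ⟨fun _ _ => rfl, fun _ _ => rfl⟩

theorem Same.trans {p : Prog} {μ μ' μ'' : Mem} (h : Same p μ μ') (h' : Same p μ' μ'') :
    Same p μ μ'' :=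
  ⟨fun r hr => (h'.reg r hr).trans (h.reg r hr), fun a ha => (h'.arr a ha).trans (h.arr a ha)⟩

theorem Same.mono {p q : Prog} {μ μ' : Mem} (h : Same p μ μ') (hr : p.regs ⊆ q.regs)
    (ha : p.arrs ⊆ q.arrs) : Same q μ μ' :=
  ⟨fun r h' => h.reg r fun x => h' (hr x), fun a h' => h.arr a fun x => h' (ha x)⟩

/-- The frame rule. What a program may write is read off its syntax, so the preservation of any
other register or array becomes a membership question for `decide`. -/
theorem Exec.same {p : Prog} {μ μ' : Mem} {t : ℕ} (h : Exec p μ t μ') : Same p μ μ' := by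
  induction h with
  | skip μ => exact .refl _ _
  | assign μ r x =>
    exact ⟨fun r' h => by simp [Prog.regs] at h; simp [h], fun _ _ => rfl⟩
  | store μ a i x =>
    exact ⟨fun _ _ => rfl, fun a' h => by simp [Prog.arrs] at h; simp [h]⟩
  | seq _ _ h1 h2 =>
    exact (h1.mono (by simp [Prog.regs]) (by simp [Prog.arrs])).trans
      (h2.mono (by simp [Prog.regs]) (by simp [Prog.arrs]))
  | cond_true _ _ h => exact h.mono (by simp [Prog.regs]) (by simp [Prog.arrs])
  | cond_false _ _ h => exact h.mono (by simp [Prog.regs]) (by simp [Prog.arrs])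
  | loop_true _ _ _ h1 h2 => exact (h1.mono (by simp [Prog.regs]) (by simp [Prog.arrs])).trans h2
  | loop_false _ => exact .refl _ _

theorem Runs.same {p : Prog} {μ : Mem} {B : ℕ} {Q : Mem → Prop} (h : Runs p μ B Q) :
    Runs p μ B fun μ' => Q μ' ∧ Same p μ μ' :=
  let ⟨t, ht, μ', he, hq⟩ := h
  ⟨t, ht, μ', he, hq, he.same⟩

theorem Runs.mono {p : Prog} {μ : Mem} {B B' : ℕ} {Q Q' : Mem → Prop} (h : Runs p μ B Q)
    (hB : B ≤ B') (hQ : ∀ μ', Q μ' → Q' μ') : Runs p μ B' Q' :=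
  let ⟨t, ht, μ', he, hq⟩ := h
  ⟨t, ht.trans hB, μ', he, hQ _ hq⟩

theorem Runs.seq {p q : Prog} {μ : Mem} {B B' : ℕ} {Q Q' : Mem → Prop} (h : Runs p μ B Q)
    (h' : ∀ μ', Same p μ μ' → Q μ' → Runs q μ' B' Q') : Runs (.seq p q) μ (B + B') Q' := by
  obtain ⟨t, ht, μ', he, hq⟩ := h
  obtain ⟨t', ht', μ'', he', hq'⟩ := h' μ' he.same hq
  exact ⟨t + t', by omega, μ'', he.seq he', hq'⟩

theorem Runs.cond {x : Expr} {p q : Prog} {μ : Mem} {B : ℕ} {Q : Mem → Prop}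
    (h : x.eval μ ≠ 0 → Runs p μ B Q) (h' : x.eval μ = 0 → Runs q μ B Q) :
    Runs (.cond x p q) μ (x.cost + 1 + B) Q := by
  by_cases hx : x.eval μ = 0
  · obtain ⟨t, ht, μ', he, hq⟩ := h' hx
    exact ⟨_, by omega, μ', .cond_false hx he, hq⟩
  · obtain ⟨t, ht, μ', he, hq⟩ := h hx
    exact ⟨_, by omega, μ', .cond_true hx he, hq⟩

/-- The effect of a program without loops. -/
def Prog.run : Prog → Mem → Mem
  | .skip, μ => μ
  | .assign r x, μ => μ.setReg r (x.eval μ)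
  | .store a i x, μ => μ.setArr a (i.eval μ) (x.eval μ)
  | .seq p q, μ => q.run (p.run μ)
  | .cond x p q, μ => if x.eval μ = 0 then q.run μ else p.run μ
  | .loop _ _, μ => μ

def Prog.straight : Prog → Bool
  | .seq p q => p.straight && q.straight
  | .cond _ p q => p.straight && q.straight
  | .loop _ _ => false
  | _ => true

/-- A bound for the number of steps of a program without loops. -/
def Prog.time : Prog → ℕ
  | .skip => 1
  | .assign _ x => x.cost + 1
  | .store _ i x => i.cost + x.cost + 1
  | .seq p q => p.time + q.time
  | .cond x p q => x.cost + 1 + max p.time q.time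
  | .loop _ _ => 0

/-- Loop-free pieces are verified by evaluation, which leaves only the loops to invariants. -/
theorem Prog.runs {p : Prog} (h : p.straight = true) (μ : Mem) :
    Runs p μ p.time fun μ' => μ' = p.run μ := by
  induction p generalizing μ with
  | skip => exact ⟨_, le_rfl, _, .skip μ, rfl⟩
  | assign r x => exact ⟨_, le_rfl, _, .assign μ r x, rfl⟩
  | store a i x => exact ⟨_, le_rfl, _, .store μ a i x, rfl⟩
  | seq p q hp hq =>
    simp only [Prog.straight, Bool.and_eq_true] at h
    exact (hp h.1 μ).seq fun μ' _ h' => h' ▸ hq h.2 _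
  | cond x p q hp hq =>
    simp only [Prog.straight, Bool.and_eq_true] at h
    refine Runs.cond (fun hx => (hp h.1 μ).mono (le_max_left _ _) ?_)
      fun hx => (hq h.2 μ).mono (le_max_right _ _) ?_ <;> simp [Prog.run, hx]
  | loop x p => simp [Prog.straight] at h

theorem Runs.of_run {p : Prog} {μ : Mem} {Q : Mem → Prop} {B : ℕ} (h : p.straight = true)
    (hB : p.time ≤ B) (hQ : Q (p.run μ)) : Runs p μ B Q :=
  (Prog.runs h μ).mono hB fun _ h' => h' ▸ hQ

/-- A loop whose number of iterations is known. -/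
theorem Runs.loop_sum {x : Expr} {p : Prog} {μ₀ : Mem} (n : ℕ) (c : ℕ → ℕ)
    (I : ℕ → Mem → Prop) (init : I 0 μ₀)
    (step : ∀ i < n, ∀ μ, Same (.loop x p) μ₀ μ → I i μ →
      x.eval μ ≠ 0 ∧ Runs p μ (c i) (I (i + 1)))
    (final : ∀ μ, Same (.loop x p) μ₀ μ → I n μ → x.eval μ = 0) :
    Runs (.loop x p) μ₀ (∑ i ∈ Finset.range n, (c i + x.cost + 1) + x.cost + 1) (I n) := by
  suffices H : ∀ d i, i + d = n → ∀ μ, Same (.loop x p) μ₀ μ → I i μ →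
      Runs (.loop x p) μ (∑ j ∈ Finset.range d, (c (i + j) + x.cost + 1) + x.cost + 1) (I n) by
    simpa using H n 0 (by simp) μ₀ (.refl _ _) init
  intro d
  induction d with
  | zero =>
    rintro i rfl μ hs hI
    exact ⟨_, by simp, μ, .loop_false (final μ hs hI), hI⟩
  | succ d ih =>
    intro i hi μ hs hI
    obtain ⟨hx, t, ht, μ', he, hI'⟩ := step i (by omega) μ hs hI
    obtain ⟨t', ht', μ'', he', hI''⟩ := ih (i + 1) (by omega) μ'
      (hs.trans (he.same.mono (by simp [Prog.regs]) (by simp [Prog.arrs]))) hI'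
    refine ⟨_, ?_, μ'', .loop_true hx he he', hI''⟩
    rw [Finset.sum_range_succ', add_zero]
    simp only [show ∀ j, i + 1 + j = i + (j + 1) by omega] at ht'
    omega

theorem Runs.loop {x : Expr} {p : Prog} {μ₀ : Mem} (n c : ℕ)
    (I : ℕ → Mem → Prop) (init : I 0 μ₀)
    (step : ∀ i < n, ∀ μ, Same (.loop x p) μ₀ μ → I i μ →
      x.eval μ ≠ 0 ∧ Runs p μ c (I (i + 1)))
    (final : ∀ μ, Same (.loop x p) μ₀ μ → I n μ → x.eval μ = 0) :
    Runs (.loop x p) μ₀ (n * (c + x.cost + 1) + x.cost + 1) (I n) := by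
  simpa using Runs.loop_sum n (fun _ => c) I init step final

/-- A loop with a variant. -/
theorem Runs.loop_variant {x : Expr} {p : Prog} {μ₀ : Mem} (n c : ℕ)
    (I : ℕ → Mem → Prop) (init : I n μ₀)
    (step : ∀ i μ, Same (.loop x p) μ₀ μ → I i μ → x.eval μ ≠ 0 →
      Runs p μ c fun μ' => ∃ i' < i, I i' μ') :
    Runs (.loop x p) μ₀ (n * (c + x.cost + 1) + x.cost + 1)
      fun μ => x.eval μ = 0 ∧ ∃ i, I i μ := by
  suffices H : ∀ n μ, Same (.loop x p) μ₀ μ → I n μ →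
      Runs (.loop x p) μ (n * (c + x.cost + 1) + x.cost + 1)
        fun μ => x.eval μ = 0 ∧ ∃ i, I i μ from H n μ₀ (.refl _ _) init
  intro n
  induction n using Nat.strong_induction_on with
  | _ n ih =>
    intro μ hs hI
    by_cases hx : x.eval μ = 0
    · exact ⟨_, by omega, μ, .loop_false hx, hx, n, hI⟩
    obtain ⟨t, ht, μ', he, i, hi, hI'⟩ := step n μ hs hI hx
    obtain ⟨t', ht', μ'', he', hI''⟩ := ih i hi μ'
      (hs.trans (he.same.mono (by simp [Prog.regs]) (by simp [Prog.arrs]))) hI'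
    refine ⟨_, ?_, μ'', .loop_true hx he he', hI''⟩
    have : (i + 1) * (c + x.cost + 1) ≤ n * (c + x.cost + 1) := Nat.mul_le_mul_right _ hi
    rw [add_mul, one_mul] at this
    omega

/-! ### Attractors -/

/-- The positions from which Eve can force a visit to `T`. -/
inductive Attr {X : Type*} (E : X → X → Prop) (eve : X → Prop) (T : X → Prop) : X → Prop
  | base {x : X} : T x → Attr E eve T x
  | eve {x y : X} : eve x → E x y → Attr E eve T y → Attr E eve T x
  | adam {x : X} : ¬ eve x → (∀ y, E x y → Attr E eve T y) → Attr E eve T x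

/-- Adding one to a register. -/
def Prog.incr (r : ℕ) : Prog := .assign r (.add (.reg r) (.const 1))

/-- Initialises the counters with `1` for Eve and `0` for Adam, and the lists of edges.
Registers: `10`, `11` numbers of vertices and edges, `12`, `13` range of the targets.
Arrays: `0` owners, `1` sources and `2` ends of the edges, `10` counters, `11` heads of the lists of
the edges with a given end, `12` next edges in these lists, `13` queue. -/
def attrInit₁ : Prog :=
  .loop (.sub (.reg 10) (.reg 20))
    (.seq (.store 10 (.reg 20) (.sub (.const 1) (.load 0 (.reg 20))))
      (.seq (.store 11 (.reg 20) (.const 0)) (.incr 20)))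

/-- Adds the outdegrees to the counters of Adam's vertices, and builds the lists of edges. -/
def attrInit₂ : Prog :=
  .loop (.sub (.reg 11) (.reg 20))
    (.seq (.store 10 (.load 1 (.reg 20))
        (.add (.load 10 (.load 1 (.reg 20))) (.load 0 (.load 1 (.reg 20)))))
      (.seq (.store 12 (.reg 20) (.load 11 (.load 2 (.reg 20))))
        (.seq (.store 11 (.load 2 (.reg 20)) (.add (.reg 20) (.const 1))) (.incr 20))))

/-- Puts the targets into the queue. -/
def attrInit₃ : Prog :=
  .loop (.sub (.reg 13) (.reg 20))
    (.seq (.store 10 (.reg 20) (.const 0))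
      (.seq (.store 13 (.reg 22) (.reg 20)) (.seq (.incr 22) (.incr 20))))

/-- Handles the edge `p - 1` of the current list, where `p` is the content of register `23`. -/
def attrEdge : Prog :=
  .seq (.assign 24 (.load 1 (.sub (.reg 23) (.const 1))))
    (.seq (.assign 23 (.load 12 (.sub (.reg 23) (.const 1))))
      (.cond (.load 10 (.reg 24))
        (.seq (.store 10 (.reg 24) (.sub (.load 10 (.reg 24)) (.const 1)))
          (.cond (.load 10 (.reg 24)) .skip
            (.seq (.store 13 (.reg 22) (.reg 24)) (.incr 22))))
        .skip))

/-- Takes a vertex from the queue. -/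
def attrPop : Prog :=
  .seq (.assign 23 (.load 11 (.load 13 (.reg 21)))) (.incr 21)

def attrMain : Prog :=
  .loop (.add (.reg 23) (.sub (.reg 22) (.reg 21))) (.cond (.reg 23) attrEdge attrPop)

/-- Computes an attractor: in the end, the counter of a vertex is `0` if and only if the vertex
belongs to the attractor. -/
def attrProg : Prog :=
  .seq (.assign 20 (.const 0)) <| .seq attrInit₁ <|
  .seq (.assign 20 (.const 0)) <| .seq attrInit₂ <|
  .seq (.seq (.assign 20 (.reg 12)) (.seq (.assign 21 (.const 0))
    (.seq (.assign 22 (.const 0)) (.assign 23 (.const 0))))) <| .seq attrInit₃ attrMain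

/-- One more than the last edge before `i` that ends in `v`, and `0` if there is none. -/
def lastBefore (dst : ℕ → ℕ) (v : ℕ) : ℕ → ℕ
  | 0 => 0
  | i + 1 => if dst i = v then i + 1 else lastBefore dst v i

theorem lastBefore_le (dst : ℕ → ℕ) (v i : ℕ) : lastBefore dst v i ≤ i := by
  induction i with
  | zero => simp [lastBefore]
  | succ i ih => simp only [lastBefore]; split <;> omega

theorem dst_lastBefore {dst : ℕ → ℕ} {v i : ℕ} (h : lastBefore dst v i ≠ 0) :
    dst (lastBefore dst v i - 1) = v := by
  induction i with
  | zero => simp [lastBefore] at h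
  | succ i ih =>
    simp only [lastBefore] at h ⊢
    split <;> simp_all

/-- Together with `dst_lastBefore`: following the lists enumerates all edges into `v` by decreasing
index, without omission. -/
theorem lt_lastBefore {dst : ℕ → ℕ} {v i e : ℕ} (he : e < i) (h : dst e = v) :
    e < lastBefore dst v i := by
  induction i with
  | zero => omega
  | succ i ih =>
    simp only [lastBefore]
    split
    · exact he
    · exact ih (by rcases Nat.lt_succ_iff_lt_or_eq.1 he with h' | rfl <;> [exact h'; contradiction])

/-- The number of edges before `i` that start in `v`. -/
def outDeg (src : ℕ → ℕ) (v i : ℕ) : ℕ := ((Finset.range i).filter (src · = v)).card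

theorem outDeg_succ (src : ℕ → ℕ) (v i : ℕ) :
    outDeg src v (i + 1) = outDeg src v i + if src i = v then 1 else 0 := by
  unfold outDeg
  rw [Finset.range_add_one, Finset.filter_insert]
  split <;> simp

/-! ### Initial counters, edge lists and queue of the attractor computation. -/

theorem attrInit₁_runs {μ : Mem} {N : ℕ} (hN : μ.reg 10 = N) (h0 : μ.reg 20 = 0) :
    Runs attrInit₁ μ (N * 19 + 4)
      fun μ' => ∀ x < N, μ'.arr 10 x = 1 - μ.arr 0 x ∧ μ'.arr 11 x = 0 := by
  refine (Runs.loop N 15 (fun i μ' => μ'.reg 20 = i ∧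
    ∀ x < i, μ'.arr 10 x = 1 - μ.arr 0 x ∧ μ'.arr 11 x = 0) (by simp [h0]) ?_ ?_).mono
    (by simp [Expr.cost]) fun μ' h => h.2
  · rintro i hi μ' hs ⟨h1, h2⟩
    have h10 := hs.reg 10 (by decide)
    have a0 := hs.arr 0 (by decide)
    refine ⟨by simp [Expr.eval]; omega, Runs.of_run rfl (by decide) ?_⟩
    simp only [Prog.run, Prog.incr, Expr.eval, Mem.setReg_reg, Mem.setReg_arr, Mem.setArr_reg,
      Mem.setArr_arr, h1, a0]
    refine ⟨by simp, fun x hx => ?_⟩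
    rcases Nat.lt_succ_iff_lt_or_eq.1 hx with hx | rfl
    · simpa [hx.ne] using h2 x hx
    · simp
  · rintro μ' hs ⟨h1, h2⟩
    have h10 := hs.reg 10 (by decide)
    simp [Expr.eval]; omega

/-- The code of the owner is added to the counter for each outgoing edge: this yields the outdegree
for Adam, whose code is 1, and nothing for Eve, whose code is 0. The old head of a list becomes the
successor of the edge put in front of it, hence `lastBefore` up to `e` in array 12. -/
theorem attrInit₂_runs {μ : Mem} {N M : ℕ} (hM : μ.reg 11 = M) (h0 : μ.reg 20 = 0)
    (hd : ∀ e < M, μ.arr 2 e < N) (hh : ∀ x < N, μ.arr 11 x = 0) :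
    Runs attrInit₂ μ (M * 34 + 4)
      fun μ' => (∀ x, μ'.arr 10 x = μ.arr 10 x + outDeg (μ.arr 1) x M * μ.arr 0 x) ∧
        (∀ x < N, μ'.arr 11 x = lastBefore (μ.arr 2) x M) ∧
        ∀ e < M, μ'.arr 12 e = lastBefore (μ.arr 2) (μ.arr 2 e) e := by
  refine (Runs.loop M 30 (fun i μ' => μ'.reg 20 = i ∧
    (∀ x, μ'.arr 10 x = μ.arr 10 x + outDeg (μ.arr 1) x i * μ.arr 0 x) ∧
        (∀ x < N, μ'.arr 11 x = lastBefore (μ.arr 2) x i) ∧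
        ∀ e < i, μ'.arr 12 e = lastBefore (μ.arr 2) (μ.arr 2 e) e)
    (by simp [h0, lastBefore, outDeg]; exact hh) ?_ ?_).mono
    (by simp [Expr.cost]) fun μ' h => h.2
  · rintro i hi μ' hs ⟨h1, h2, h3, h4⟩
    have r11 := hs.reg 11 (by decide)
    have a0 := hs.arr 0 (by decide)
    have a1 := hs.arr 1 (by decide)
    have a2 := hs.arr 2 (by decide)
    refine ⟨by simp [Expr.eval]; omega, Runs.of_run rfl (by decide) ?_⟩
    simp only [Prog.run, Prog.incr, Expr.eval, Mem.setReg_reg, Mem.setReg_arr, Mem.setArr_reg,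
      Mem.setArr_arr, h1, a0, a1, a2]
    refine ⟨by simp, fun x => ?_, fun x hx => ?_, fun x hx => ?_⟩
    · rw [outDeg_succ]
      by_cases hx : x = μ.arr 1 i
      · simp [hx, h2, add_mul, add_assoc]
      · simp [Function.update_of_ne hx, Ne.symm hx, h2]
    · by_cases hx' : x = μ.arr 2 i
      · simp [hx', lastBefore]
      · simp [hx', Ne.symm hx', lastBefore, h3 x hx]
    · rcases Nat.lt_succ_iff_lt_or_eq.1 hx with hx | rfl
      · simpa [hx.ne] using h4 x hx
      · simp [h3 _ (hd _ hi)]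
  · rintro μ' hs ⟨h1, h2⟩
    have r11 := hs.reg 11 (by decide)
    simp [Expr.eval]; omega

theorem attrInit₃_runs {μ : Mem} {a b : ℕ} (hb : μ.reg 13 = b) (h0 : μ.reg 20 = a)
    (h22 : μ.reg 22 = 0) :
    Runs attrInit₃ μ ((b - a) * 19 + 4)
      fun μ' => μ'.reg 22 = b - a ∧
        (∀ x, μ'.arr 10 x = if a ≤ x ∧ x < b then 0 else μ.arr 10 x) ∧
        ∀ i < b - a, μ'.arr 13 i = a + i := by
  refine (Runs.loop (b - a) 15 (fun i μ' => μ'.reg 20 = a + i ∧ μ'.reg 22 = i ∧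
        (∀ x, μ'.arr 10 x = if a ≤ x ∧ x < a + i then 0 else μ.arr 10 x) ∧
        ∀ j < i, μ'.arr 13 j = a + j)
    ⟨by simp [h0], h22, fun x => ?_, by simp⟩ ?_ ?_).mono
    (by simp [Expr.cost]) fun μ' h => ⟨h.2.1, fun x => ?_, h.2.2.2⟩
  · rw [if_neg (by omega)]
  · rintro i hi μ' hs ⟨h1, h2, h3, h4⟩
    have r13 := hs.reg 13 (by decide)
    refine ⟨by simp [Expr.eval]; omega, Runs.of_run rfl (by decide) ?_⟩
    simp only [Prog.run, Prog.incr, Expr.eval, Mem.setReg_reg, Mem.setReg_arr, Mem.setArr_reg,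
      Mem.setArr_arr, h1]
    refine ⟨by simp [add_assoc], by simp [h2], fun x => ?_, fun x hx => ?_⟩
    · by_cases hx : x = a + i
      · simp [hx]
      · simp only [Nat.reduceEqDiff, if_true, if_false,
          Function.update_of_ne hx, h3]
        exact if_congr (by omega) rfl rfl
    · rcases Nat.lt_succ_iff_lt_or_eq.1 hx with hx | rfl
      · simpa [h2, hx.ne] using h4 x hx
      · simp [h2]
  · rintro μ' hs ⟨h1, h2⟩
    have r13 := hs.reg 13 (by decide)
    simp [Expr.eval]; omega
  · rw [h.2.2.1]
    exact if_congr (by omega) rfl rfl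

open scoped Classical in
/-- The edges that have been handled: those into vertices taken from the queue, except for the
rest of the current list. -/
noncomputable def handled (dst que : ℕ → ℕ) (M qh p : ℕ) : Finset ℕ :=
  (Finset.range M).filter fun e => (∃ i < qh, que i = dst e) ∧ ¬ (e < p ∧ dst e = que (qh - 1))

/-- The invariant of the computation of an attractor. -/
structure AttrInv (src dst own : ℕ → ℕ) (a b N M : ℕ) (need que : ℕ → ℕ) (qh qt p : ℕ) : Prop where
  inj : ∀ i < qt, ∀ j < qt, que i = que j → i = j
  lt : ∀ i < qt, que i < N
  need_que : ∀ i < qt, need (que i) = 0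
  mem_que : ∀ x < N, need x = 0 → ∃ i < qt, que i = x
  sound : ∀ x < N, need x = 0 →
    Attr (fun x y => ∃ e < M, src e = x ∧ dst e = y) (own · = 0) (fun x => a ≤ x ∧ x < b) x
  need_eq : ∀ x < N, need x = (if a ≤ x ∧ x < b then 0 else 1 - own x + outDeg src x M * own x) -
    ((handled dst que M qh p).filter (src · = x)).card
  le : qh ≤ qt
  cur : p ≠ 0 → 0 < qh ∧ p ≤ M ∧ dst (p - 1) = que (qh - 1)

/-! ### Preservation of the attractor invariant. -/

theorem AttrInv.le_card {src dst own : ℕ → ℕ} {a b N M : ℕ} {need que : ℕ → ℕ} {qh qt p : ℕ}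
    (h : AttrInv src dst own a b N M need que qh qt p) : qt ≤ N := by
  simpa using Finset.card_le_card_of_injOn (s := Finset.range qt) (t := Finset.range N) que
    (fun i hi => by simpa using h.lt i (by simpa using hi))
    (fun i hi j hj => h.inj i (by simpa using hi) j (by simpa using hj))

theorem card_handled_le (dst que : ℕ → ℕ) (M qh p : ℕ) : (handled dst que M qh p).card ≤ M :=
  (Finset.card_filter_le _ _).trans (by simp)

/-- A vertex outside the targets starts with 1 (Eve) or its outdegree (Adam). Both are positive
because every vertex has a successor, so the zero counters are exactly those of the targets in the
queue. -/
theorem AttrInv.init {src dst own : ℕ → ℕ} {a b N M : ℕ} {need que : ℕ → ℕ} (hb : b ≤ N)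
    (hpos : ∀ x < N, 0 < outDeg src x M) (hown : ∀ x < N, own x ≤ 1)
    (hneed : ∀ x < N, need x =
      if a ≤ x ∧ x < b then 0 else 1 - own x + outDeg src x M * own x)
    (hque : ∀ i < b - a, que i = a + i) :
    AttrInv src dst own a b N M need que 0 (b - a) 0 := by
  have hT : ∀ x < N, need x = 0 → a ≤ x ∧ x < b := by
    intro x hx h
    by_contra hab
    rw [hneed x hx, if_neg hab] at h
    have := hpos x hx
    have := hown x hx
    interval_cases own x <;> omega
  refine ⟨fun i hi j hj h => ?_, fun i hi => ?_, fun i hi => ?_, fun x hx h => ?_,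
    fun x hx h => .base (hT x hx h), fun x hx => ?_, by omega, by simp⟩
  · rw [hque i hi, hque j hj] at h; omega
  · rw [hque i hi]; omega
  · rw [hque i hi, hneed _ (by omega), if_pos (by omega)]
  · have := hT x hx h
    exact ⟨x - a, by omega, by rw [hque _ (by omega)]; omega⟩
  · rw [hneed x hx]; simp [handled]

/-- The whole list of the new vertex is pending, so no edge becomes handled; as queue entries are
distinct, none of its edges was handled before. -/
theorem AttrInv.pop {src dst own : ℕ → ℕ} {a b N M : ℕ} {need que : ℕ → ℕ} {qh qt : ℕ}
    (h : AttrInv src dst own a b N M need que qh qt 0) (hlt : qh < qt) :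
    AttrInv src dst own a b N M need que (qh + 1) qt (lastBefore dst (que qh) M) ∧
      handled dst que M (qh + 1) (lastBefore dst (que qh) M) = handled dst que M qh 0 := by
  have hP : handled dst que M (qh + 1) (lastBefore dst (que qh) M) = handled dst que M qh 0 := by
    ext e
    simp only [handled, Finset.mem_filter, Finset.mem_range, Nat.add_sub_cancel]
    constructor
    · rintro ⟨he, ⟨i, hi, hie⟩, hn⟩
      refine ⟨he, ⟨i, ?_, hie⟩, by simp⟩
      rcases Nat.lt_succ_iff_lt_or_eq.1 hi with hi | rfl
      · exact hi
      · exact absurd ⟨lt_lastBefore he hie.symm, hie.symm⟩ hn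
    · rintro ⟨he, ⟨i, hi, hie⟩, -⟩
      refine ⟨he, ⟨i, by omega, hie⟩, fun hc => ?_⟩
      have := h.inj i (by omega) qh hlt (hie.trans hc.2)
      omega
  exact ⟨⟨h.inj, h.lt, h.need_que, h.mem_que, h.sound, by rw [hP]; exact h.need_eq, hlt,
    fun hp => ⟨by omega, lastBefore_le _ _ _, by simpa using dst_lastBefore hp⟩⟩, hP⟩

/-- Pending edges of the current list are those of index below the pointer. Between the next list
entry and `p` no edge has the end `dst p`, so moving the pointer releases `p` alone. -/
theorem handled_edge {dst que : ℕ → ℕ} {M qh p : ℕ} (hq : 0 < qh) (hp : p < M)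
    (hc : dst p = que (qh - 1)) :
    handled dst que M qh (lastBefore dst (dst p) p) = insert p (handled dst que M qh (p + 1)) ∧
      p ∉ handled dst que M qh (p + 1) := by
  constructor
  · ext e
    have hle := lastBefore_le dst (dst p) p
    simp only [handled, Finset.mem_filter, Finset.mem_range, Finset.mem_insert]
    constructor
    · rintro ⟨he, hi, hn⟩
      by_cases hep : e = p
      · exact .inl hep
      · refine .inr ⟨he, hi, fun hc' => hn ⟨lt_lastBefore (by omega) ?_, hc'.2⟩⟩
        rw [hc'.2, hc]
    · rintro (rfl | ⟨he, hi, hn⟩)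
      · exact ⟨hp, ⟨qh - 1, by omega, hc.symm⟩, by omega⟩
      · exact ⟨he, hi, fun hc' => hn ⟨by omega, hc'.2⟩⟩
  · simp [handled, hc]

/-- When the queue is exhausted, every edge into a vertex with counter 0 is handled. By induction
along the attractor, a vertex of Eve has then lost its only unit, and a vertex of Adam one unit for
each outgoing edge. -/
theorem AttrInv.finish {src dst own : ℕ → ℕ} {a b N M : ℕ} {need que : ℕ → ℕ} {q : ℕ}
    (hdst : ∀ e < M, dst e < N) (hown : ∀ x < N, own x ≤ 1)
    (h : AttrInv src dst own a b N M need que q q 0) (x : ℕ) (hx : x < N) :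
    need x = 0 ↔ Attr (fun x y => ∃ e < M, src e = x ∧ dst e = y) (own · = 0)
      (fun x => a ≤ x ∧ x < b) x := by
  refine ⟨h.sound x hx, fun hA => ?_⟩
  have key : ∀ e < M, need (dst e) = 0 → e ∈ handled dst que M q 0 := fun e he hn => by
    obtain ⟨i, hi, hie⟩ := h.mem_que _ (hdst e he) hn
    simp only [handled, Finset.mem_filter, Finset.mem_range]
    exact ⟨he, ⟨i, hi, hie⟩, by simp⟩
  induction hA with
  | base hT => rw [h.need_eq _ hx, if_pos hT, Nat.zero_sub]
  | @eve x y hx' hE _ ih =>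
    obtain ⟨e, he, rfl, rfl⟩ := hE
    have : 0 < ((handled dst que M q 0).filter (src · = src e)).card :=
      Finset.card_pos.2 ⟨e, by simp [key e he (ih (hdst e he))]⟩
    rw [h.need_eq _ hx, hx']
    split <;> omega
  | @adam x hx' _ ih =>
    have h1 : own x = 1 := by have := hown x hx; omega
    have : outDeg src x M ≤ ((handled dst que M q 0).filter (src · = x)).card := by
      refine Finset.card_le_card fun e he => ?_
      simp only [Finset.mem_filter, Finset.mem_range] at he ⊢
      exact ⟨key e he.1 (ih _ ⟨e, he.1, he.2, rfl⟩ (hdst e he.1)), he.2⟩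
    rw [h.need_eq _ hx, h1]
    split <;> omega

/-- For Adam, a counter equal to 1 says that all outgoing edges but one are handled, and `p` is the
missing one. By counting, each successor is `dst p` or the end of a handled edge, and these lie in
the attractor. -/
theorem AttrInv.edge_sound {src dst own : ℕ → ℕ} {a b N M : ℕ} {need que : ℕ → ℕ} {qh qt p : ℕ}
    (hdst : ∀ e < M, dst e < N) (hown : ∀ x < N, own x ≤ 1)
    (h : AttrInv src dst own a b N M need que qh qt (p + 1)) (hu : src p < N)
    (h1 : need (src p) = 1) :
    Attr (fun x y => ∃ e < M, src e = x ∧ dst e = y) (own · = 0) (fun x => a ≤ x ∧ x < b)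
      (src p) := by
  obtain ⟨hq, hp, hc⟩ := h.cur (by omega)
  have hsound : ∀ e ∈ handled dst que M qh (p + 1), Attr (fun x y => ∃ e < M, src e = x ∧ dst e = y)
      (own · = 0) (fun x => a ≤ x ∧ x < b) (dst e) := fun e he => by
    simp only [handled, Finset.mem_filter, Finset.mem_range] at he
    obtain ⟨he, ⟨i, hi, hie⟩, -⟩ := he
    exact h.sound _ (hdst e he) (hie ▸ h.need_que i (by have := h.le; omega))
  have hsoundp : Attr (fun x y => ∃ e < M, src e = x ∧ dst e = y)
      (own · = 0) (fun x => a ≤ x ∧ x < b) (dst p) := by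
    simp only [Nat.add_sub_cancel] at hc
    exact h.sound _ (hdst p hp) (hc ▸ h.need_que _ (by have := h.le; omega))
  by_cases ho : own (src p) = 0
  · exact .eve ho ⟨p, hp, rfl, rfl⟩ hsoundp
  refine .adam ho ?_
  rintro _ ⟨e, he, hes, rfl⟩
  have h1' := h.need_eq _ hu
  have ho1 : own (src p) = 1 := by have := hown _ hu; omega
  rw [h1, ho1] at h1'
  obtain ⟨hins, hnot⟩ := handled_edge (dst := dst) (que := que) (M := M) (p := p) hq hp (by simpa using hc)
  have hcard : ((insert p (handled dst que M qh (p + 1))).filter (src · = src p)).card =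
      ((handled dst que M qh (p + 1)).filter (src · = src p)).card + 1 := by
    rw [Finset.filter_insert, if_pos rfl, Finset.card_insert_of_notMem]
    simp [hnot]
  have hle : outDeg src (src p) M ≤
      ((insert p (handled dst que M qh (p + 1))).filter (src · = src p)).card := by
    rw [hcard]
    split at h1' <;> omega
  have hsub : (insert p (handled dst que M qh (p + 1))).filter (src · = src p) ⊆
      (Finset.range M).filter (src · = src p) := by
    refine Finset.filter_subset_filter _ (Finset.insert_subset (by simpa using hp) ?_)
    exact Finset.filter_subset _ _
  have heq := Finset.eq_of_subset_of_card_le hsub hle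
  have hmem : e ∈ (insert p (handled dst que M qh (p + 1))).filter (src · = src p) := by
    rw [heq]; simp [he, hes]
  rcases Finset.mem_insert.1 (Finset.mem_filter.1 hmem).1 with rfl | hm
  · exact hsoundp
  · exact hsound e hm

theorem handled_congr {dst que que' : ℕ → ℕ} {M qh p : ℕ} (h : ∀ i < qh, que' i = que i)
    (hq : 0 < qh) : handled dst que' M qh p = handled dst que M qh p := by
  ext e
  simp only [handled, Finset.mem_filter, Finset.mem_range, h (qh - 1) (by omega)]
  refine and_congr_right fun _ => and_congr_left fun _ => ?_
  exact ⟨fun ⟨i, hi, h'⟩ => ⟨i, hi, h i hi ▸ h'⟩, fun ⟨i, hi, h'⟩ => ⟨i, hi, (h i hi).symm ▸ h'⟩⟩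

/-- The step for an edge whose source is already in the attractor. -/
theorem AttrInv.edge_zero {src dst own : ℕ → ℕ} {a b N M : ℕ} {need que : ℕ → ℕ} {qh qt p : ℕ}
    (h : AttrInv src dst own a b N M need que qh qt (p + 1)) (h0 : need (src p) = 0) :
    AttrInv src dst own a b N M need que qh qt (lastBefore dst (dst p) p) ∧
      (handled dst que M qh (lastBefore dst (dst p) p)).card =
        (handled dst que M qh (p + 1)).card + 1 := by
  obtain ⟨hq, hp, hc⟩ := h.cur (by omega)
  obtain ⟨hins, hnot⟩ := handled_edge (dst := dst) (que := que) (M := M) (p := p) hq hp (by simpa using hc)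
  rw [hins, Finset.card_insert_of_notMem hnot]
  refine ⟨⟨h.inj, h.lt, h.need_que, h.mem_que, h.sound, fun x hx => ?_, h.le, fun hp' =>
    ⟨hq, (lastBefore_le _ _ _).trans (by omega), by rw [dst_lastBefore hp']; simpa using hc⟩⟩, rfl⟩
  rw [hins, Finset.filter_insert]
  by_cases hs : src p = x
  · subst hs
    -- A counter that has reached 0 stays there, as subtraction is truncated in `need_eq`.
    rw [if_pos rfl, Finset.card_insert_of_notMem (by simp [hnot]), h0]
    have := h.need_eq _ hx
    omega
  · rw [if_neg hs]
    exact h.need_eq x hx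

/-- The step for an edge whose source has a positive counter. -/
theorem AttrInv.edge_pos {src dst own : ℕ → ℕ} {a b N M : ℕ} {need que : ℕ → ℕ} {qh qt p : ℕ}
    (hsrc : ∀ e < M, src e < N) (hdst : ∀ e < M, dst e < N) (hown : ∀ x < N, own x ≤ 1)
    (h : AttrInv src dst own a b N M need que qh qt (p + 1)) (h0 : need (src p) ≠ 0)
    {need' que' : ℕ → ℕ} {qt' : ℕ}
    (hneed' : need' = Function.update need (src p) (need (src p) - 1))
    (hque' : que' = if need (src p) - 1 = 0 then Function.update que qt (src p) else que)
    (hqt' : qt' = if need (src p) - 1 = 0 then qt + 1 else qt) :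
    AttrInv src dst own a b N M need' que' qh qt' (lastBefore dst (dst p) p) ∧
      (handled dst que' M qh (lastBefore dst (dst p) p)).card =
        (handled dst que M qh (p + 1)).card + 1 := by
  obtain ⟨hq, hp, hc⟩ := h.cur (by omega)
  have hle := h.le
  have hqq : ∀ i < qt, que' i = que i := fun i hi => by
    rw [hque']; split
    · rw [Function.update_of_ne hi.ne]
    · rfl
  have hqq' : ∀ i < qt', i < qt ∧ que' i = que i ∨
      need (src p) = 1 ∧ i = qt ∧ que' i = src p := fun i hi => by
    by_cases hi' : i < qt
    · exact .inl ⟨hi', hqq i hi'⟩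
    · rw [hqt'] at hi
      split at hi
      · next h1 =>
        have : i = qt := by omega
        exact .inr ⟨by omega, this, by rw [hque', if_pos h1, this, Function.update_self]⟩
      · exact absurd hi hi'
  -- A vertex with positive counter is not yet queued, so appending it keeps the entries distinct.
  have hne : ∀ i < qt, que i ≠ src p := fun i hi h' => h0 (h' ▸ h.need_que i hi)
  obtain ⟨hins, hnot⟩ := handled_edge (dst := dst) (que := que) (M := M) (p := p) hq hp (by simpa using hc)
  rw [handled_congr (fun i hi => hqq i (by omega)) hq, hins, Finset.card_insert_of_notMem hnot]
  have hu := hsrc p (by omega)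
  refine ⟨⟨fun i hi j hj hij => ?_, fun i hi => ?_, fun i hi => ?_, fun x hx hx0 => ?_,
    fun x hx hx0 => ?_, fun x hx => ?_, ?_, fun hp' =>
    ⟨hq, (lastBefore_le _ _ _).trans (by omega), ?_⟩⟩, rfl⟩
  · rcases hqq' i hi with ⟨hi, h1⟩ | ⟨-, rfl, h1⟩ <;> rcases hqq' j hj with ⟨hj, h2⟩ | ⟨-, rfl, h2⟩
    · exact h.inj i hi j hj (by rw [← h1, ← h2, hij])
    · exact absurd (h1.symm.trans (hij.trans h2)) (hne i hi)
    · exact absurd (h2.symm.trans (hij.symm.trans h1)) (hne j hj)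
    · rfl
  · rcases hqq' i hi with ⟨hi, h1⟩ | ⟨-, rfl, h1⟩
    · rw [h1]; exact h.lt i hi
    · rw [h1]; exact hu
  · rcases hqq' i hi with ⟨hi, h1⟩ | ⟨h2, rfl, h1⟩
    · rw [h1, hneed', Function.update_of_ne (hne i hi)]; exact h.need_que i hi
    · rw [h1, hneed', Function.update_self, h2]
  · by_cases hxu : x = src p
    · subst hxu
      rw [hneed', Function.update_self] at hx0
      exact ⟨qt, by rw [hqt', if_pos hx0]; omega,
        by rw [hque', if_pos hx0, Function.update_self]⟩
    · rw [hneed', Function.update_of_ne hxu] at hx0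
      obtain ⟨i, hi, hi'⟩ := h.mem_que x hx hx0
      exact ⟨i, by rw [hqt']; split <;> omega, by rw [hqq i hi, hi']⟩
  · by_cases hxu : x = src p
    · subst hxu
      rw [hneed', Function.update_self] at hx0
      exact h.edge_sound hdst hown hu (by omega)
    · rw [hneed', Function.update_of_ne hxu] at hx0
      exact h.sound x hx hx0
  · rw [handled_congr (fun i hi => hqq i (by omega)) hq, hins, Finset.filter_insert]
    by_cases hxu : x = src p
    · subst hxu
      rw [if_pos rfl, Finset.card_insert_of_notMem (by simp [hnot]), hneed', Function.update_self]
      have := h.need_eq _ hx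
      omega
    · rw [if_neg (Ne.symm hxu), hneed', Function.update_of_ne hxu]
      exact h.need_eq x hx
  · rw [hqt']; split <;> omega
  · rw [dst_lastBefore hp', hqq _ (by omega)]; simpa using hc

/-- Each round takes a vertex from the queue or handles an edge. The former happens at most `N`
times, the latter at most `M` times, so `N + M` minus both counts is a variant. -/
theorem attrMain_runs {μ : Mem} {src dst own : ℕ → ℕ} {a b N M qt : ℕ}
    (hsrc : ∀ e < M, src e < N) (hdst : ∀ e < M, dst e < N) (hown : ∀ x < N, own x ≤ 1)
    (h1 : μ.arr 1 = src) (h11 : ∀ x < N, μ.arr 11 x = lastBefore dst x M)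
    (h12 : ∀ e < M, μ.arr 12 e = lastBefore dst (dst e) e)
    (h21 : μ.reg 21 = 0) (h22 : μ.reg 22 = qt) (h23 : μ.reg 23 = 0)
    (hI : AttrInv src dst own a b N M (μ.arr 10) (μ.arr 13) 0 qt 0) :
    Runs attrMain μ ((N + M) * 50 + 6) fun μ' => ∀ x < N, μ'.arr 10 x = 0 ↔
      Attr (fun x y => ∃ e < M, src e = x ∧ dst e = y) (own · = 0) (fun x => a ≤ x ∧ x < b) x := by
  refine (Runs.loop_variant (N + M) 44 (fun v μ' =>
    AttrInv src dst own a b N M (μ'.arr 10) (μ'.arr 13) (μ'.reg 21) (μ'.reg 22) (μ'.reg 23) ∧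
      v + μ'.reg 21 + (handled dst (μ'.arr 13) M (μ'.reg 21) (μ'.reg 23)).card = N + M)
    ⟨by rw [h21, h22, h23]; exact hI, by simp [h21, handled]⟩ ?_).mono (by simp [Expr.cost]) ?_
  · rintro i μ' hs ⟨hI, hv⟩ hx
    have a1 := (hs.arr 1 (by decide)).trans h1
    have a11 := hs.arr 11 (by decide)
    have a12 := hs.arr 12 (by decide)
    have hqt := hI.le
    have hqN := hI.le_card
    simp only [Expr.eval] at hx
    refine (Runs.cond (B := 42) (fun hp => ?_) (fun hp => ?_)).mono (by decide) fun _ h => h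
    · simp only [Expr.eval] at hp
      obtain ⟨p, hp⟩ := Nat.exists_eq_add_one_of_ne_zero hp
      rw [hp] at hI hv
      have hpM := (hI.cur (by omega)).2.1
      have hp12 := h12 p hpM
      refine Runs.of_run rfl (by decide) ?_
      by_cases h0 : μ'.arr 10 (src p) = 0
      · obtain ⟨h, hc⟩ := hI.edge_zero h0
        have hle := card_handled_le dst (μ'.arr 13) M (μ'.reg 21) (lastBefore dst (dst p) p)
        refine ⟨i - 1, by omega, ?_⟩
        simp only [attrEdge, Prog.run, Prog.incr, Expr.eval, Mem.setReg_reg, Mem.setReg_arr,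
          Mem.setArr_reg, Mem.setArr_arr, a1, a12, hp, hp12,
          Nat.add_sub_cancel, h0, Nat.reduceEqDiff, if_true, if_false]
        exact ⟨h, by omega⟩
      · obtain ⟨h, hc⟩ := hI.edge_pos hsrc hdst hown h0 rfl rfl rfl
        have hle := card_handled_le dst (if μ'.arr 10 (src p) - 1 = 0 then
            Function.update (μ'.arr 13) (μ'.reg 22) (src p) else μ'.arr 13) M (μ'.reg 21)
              (lastBefore dst (dst p) p)
        refine ⟨i - 1, by omega, ?_⟩
        by_cases h1 : μ'.arr 10 (src p) - 1 = 0 <;>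
        simp only [h1, if_true, if_false] at h hc hle <;>
        simp only [attrEdge, Prog.run, Prog.incr, Expr.eval, Mem.setReg_reg, Mem.setReg_arr,
          Mem.setArr_reg, Mem.setArr_arr, a1, a12, hp, hp12,
          Nat.add_sub_cancel, h0, Nat.reduceEqDiff, if_true, if_false, Function.update_self, h1] <;>
        exact ⟨h, by omega⟩
    · simp only [Expr.eval] at hp
      rw [hp] at hI hv
      have hlt : μ'.reg 21 < μ'.reg 22 := by omega
      obtain ⟨h, hc⟩ := hI.pop hlt
      have hp11 := h11 _ (hI.lt _ hlt)
      have hcard := congrArg Finset.card hc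
      have hle := card_handled_le dst (μ'.arr 13) M (μ'.reg 21) 0
      refine Runs.of_run rfl (by decide) ⟨i - 1, by omega, ?_⟩
      simp only [attrPop, Prog.run, Prog.incr, Expr.eval, Mem.setReg_reg, Mem.setReg_arr,
        a11, hp11, Nat.reduceEqDiff, if_true, if_false]
      exact ⟨h, by omega⟩
  · rintro μ' ⟨hx, v, hI, -⟩
    simp only [Expr.eval] at hx
    have := hI.le
    rw [show μ'.reg 22 = μ'.reg 21 by omega, show μ'.reg 23 = 0 by omega] at hI
    exact hI.finish hdst hown

theorem attrProg_runs {μ : Mem} {a b N M : ℕ} (hN : μ.reg 10 = N) (hM : μ.reg 11 = M)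
    (ha : μ.reg 12 = a) (hb : μ.reg 13 = b) (hbN : b ≤ N)
    (hsrc : ∀ e < M, μ.arr 1 e < N) (hdst : ∀ e < M, μ.arr 2 e < N)
    (hown : ∀ x < N, μ.arr 0 x ≤ 1) (hpos : ∀ x < N, ∃ e < M, μ.arr 1 e = x) :
    Runs attrProg μ ((N + M) * 90 + 50) fun μ' => ∀ x < N, μ'.arr 10 x = 0 ↔
      Attr (fun x y => ∃ e < M, μ.arr 1 e = x ∧ μ.arr 2 e = y) (μ.arr 0 · = 0)
        (fun x => a ≤ x ∧ x < b) x := by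
  refine (((Prog.runs rfl μ).mono (B' := 2) (by decide) fun _ h => h).seq fun μ₁ s₁ h₁ => ?_).mono
    (B := 2 + (N * 19 + 4 + (2 + (M * 34 + 4 + (8 + (N * 19 + 4 + ((N + M) * 50 + 6)))))))
    (by omega) fun _ h => h
  have hz₁ : μ₁.reg 20 = 0 := by simp [h₁, Prog.run, Expr.eval]
  refine (attrInit₁_runs ((s₁.reg 10 (by decide)).trans hN) hz₁).seq fun μ₂ s₂ h₂ => ?_
  rw [s₁.arr 0 (by decide)] at h₂
  refine ((Prog.runs rfl μ₂).mono (by decide) fun _ h => h).seq fun μ₃ s₃ h₃ => ?_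
  have hz₃ : μ₃.reg 20 = 0 := by simp [h₃, Prog.run, Expr.eval]
  have a1 : μ₃.arr 1 = μ.arr 1 := by
    rw [s₃.arr 1 (by decide), s₂.arr 1 (by decide), s₁.arr 1 (by decide)]
  have a2 : μ₃.arr 2 = μ.arr 2 := by
    rw [s₃.arr 2 (by decide), s₂.arr 2 (by decide), s₁.arr 2 (by decide)]
  have a0 : μ₃.arr 0 = μ.arr 0 := by
    rw [s₃.arr 0 (by decide), s₂.arr 0 (by decide), s₁.arr 0 (by decide)]
  have a10 : μ₃.arr 10 = μ₂.arr 10 := s₃.arr 10 (by decide)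
  have a11 : μ₃.arr 11 = μ₂.arr 11 := s₃.arr 11 (by decide)
  refine (attrInit₂_runs (N := N) (M := M) ?_ hz₃ (by rw [a2]; exact hdst)
    (by rw [a11]; exact fun x hx => (h₂ x hx).2)).seq fun μ₄ s₄ h₄ => ?_
  · rw [s₃.reg 11 (by decide), s₂.reg 11 (by decide), s₁.reg 11 (by decide), hM]
  rw [a0, a1, a2, a10] at h₄
  obtain ⟨h₄, h₄', h₄''⟩ := h₄
  refine ((Prog.runs rfl μ₄).mono (by decide) fun _ h => h).seq fun μ₅ s₅ h₅ => ?_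
  have r12 : μ₄.reg 12 = a := by
    rw [s₄.reg 12 (by decide), s₃.reg 12 (by decide), s₂.reg 12 (by decide), s₁.reg 12 (by decide),
      ha]
  have r13 : μ₅.reg 13 = b := by
    rw [s₅.reg 13 (by decide), s₄.reg 13 (by decide), s₃.reg 13 (by decide), s₂.reg 13 (by decide),
      s₁.reg 13 (by decide), hb]
  refine ((attrInit₃_runs r13 (a := a) (by simp [h₅, Prog.run, Expr.eval, r12])
    (by simp [h₅, Prog.run, Expr.eval])).mono (B' := N * 19 + 4) (by
      have := Nat.mul_le_mul_right 19 ((Nat.sub_le b a).trans hbN); omega) fun _ h => h).seq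
    fun μ₆ s₆ h₆ => ?_
  obtain ⟨h₆, h₆', h₆''⟩ := h₆
  rw [s₅.arr 10 (by decide)] at h₆'
  refine attrMain_runs (dst := μ.arr 2) hsrc hdst hown (a := a) (b := b) (qt := b - a) ?_
    ?_ ?_ ?_ h₆ ?_ ?_
  · rw [s₆.arr 1 (by decide), s₅.arr 1 (by decide), s₄.arr 1 (by decide), a1]
  · rwa [s₆.arr 11 (by decide), s₅.arr 11 (by decide)]
  · rwa [s₆.arr 12 (by decide), s₅.arr 12 (by decide)]
  · rw [s₆.reg 21 (by decide), h₅]; simp [Prog.run, Expr.eval]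
  · rw [s₆.reg 23 (by decide), h₅]; simp [Prog.run, Expr.eval]
  · refine .init hbN (fun x hx => ?_) hown (fun x hx => ?_) h₆''
    · obtain ⟨e, he, hex⟩ := hpos x hx
      exact Finset.card_pos.2 ⟨e, by simp [he, hex]⟩
    · rw [h₆', h₄, (h₂ x hx).1]

/-! ### Products of a graph with a monitor -/

/-- Computes the multiples of the number of vertices. Registers: `10` number of vertices,
`14` number of levels. Arrays: `17` multiples. -/
def prodOffsets : Prog :=
  .loop (.sub (.reg 14) (.reg 20))
    (.seq (.assign 21 (.add (.reg 21) (.reg 10)))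
      (.seq (.incr 20) (.store 17 (.reg 20) (.reg 21))))

/-- Copies the ends of the edges to the array `18`. -/
def prodCopy : Prog :=
  .loop (.sub (.reg 11) (.reg 20))
    (.seq (.store 18 (.reg 20) (.load 2 (.reg 20))) (.incr 20))

/-- Builds the edges of the product. Arrays: `14` labels of the vertices, `15` the level at which a
label makes the monitor jump, `16` the target of this jump. -/
def prodEdges : Prog :=
  .loop (.sub (.reg 14) (.reg 26))
    (.seq (.assign 24 (.load 14 (.load 1 (.reg 25))))
      (.seq (.cond (.add (.sub (.load 15 (.reg 24)) (.reg 26)) (.sub (.reg 26) (.load 15 (.reg 24))))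
          (.assign 27 (.reg 26)) (.assign 27 (.load 16 (.reg 24))))
        (.seq (.store 1 (.reg 20) (.add (.load 1 (.reg 25)) (.load 17 (.reg 26))))
          (.seq (.store 2 (.reg 20) (.add (.load 18 (.reg 25)) (.load 17 (.reg 27))))
            (.seq (.incr 20) (.seq (.incr 25)
              (.cond (.sub (.reg 11) (.reg 25)) .skip
                (.seq (.assign 25 (.const 0)) (.incr 26)))))))))

/-- Builds the vertices of the product. -/
def prodVertices : Prog :=
  .loop (.sub (.load 17 (.reg 14)) (.reg 20))
    (.seq (.store 0 (.reg 20) (.load 0 (.sub (.reg 20) (.reg 10))))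
      (.seq (.store 14 (.reg 20) (.load 14 (.sub (.reg 20) (.reg 10)))) (.incr 20)))

/-- Replaces a graph by its product with a monitor. -/
def prodProg : Prog :=
  .seq (.seq (.assign 20 (.const 0)) (.seq (.assign 21 (.const 0))
    (.store 17 (.const 0) (.const 0)))) <| .seq prodOffsets <|
  .seq (.assign 20 (.const 0)) <| .seq prodCopy <|
  .seq (.seq (.assign 20 (.const 0)) (.seq (.assign 25 (.const 0)) (.assign 26 (.const 0)))) <|
  .seq prodEdges <|
  .seq (.seq (.assign 11 (.reg 20)) (.assign 20 (.reg 10))) <| .seq prodVertices <|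
  .assign 10 (.load 17 (.reg 14))

/-- The level of a monitor that jumps at the level `l` to the level `h`. -/
def jump (l h c : ℕ) : ℕ := if l = c then h else c

/-- Registers 25 and 26 of `prodEdges` follow the remainder and the quotient of the loop index by
`M`, on a machine without division. -/
theorem add_one_div_mod (M i : ℕ) (hM : 0 < M) :
    (i + 1) / M = (if i % M + 1 < M then i / M else i / M + 1) ∧
      (i + 1) % M = if i % M + 1 < M then i % M + 1 else 0 := by
  have h1 := Nat.mod_add_div i M
  have h2 := Nat.mod_lt i hM
  rw [Nat.div_mod_unique hM]
  split
  · omega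
  · rw [mul_add]; omega

theorem prodOffsets_runs {μ : Mem} {N L : ℕ} (hN : μ.reg 10 = N) (hL : μ.reg 14 = L)
    (h20 : μ.reg 20 = 0) (h21 : μ.reg 21 = 0) (h17 : μ.arr 17 0 = 0) :
    Runs prodOffsets μ (L * 20 + 4) fun μ' => ∀ c ≤ L, μ'.arr 17 c = c * N := by
  refine (Runs.loop L 14 (fun i μ' => μ'.reg 20 = i ∧ μ'.reg 21 = i * N ∧
    ∀ c ≤ i, μ'.arr 17 c = c * N) (by simp [h20, h21, h17]) ?_ ?_).mono
    (by simp [Expr.cost]; omega) fun μ' h => h.2.2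
  · rintro i hi μ' hs ⟨h1, h2, h3⟩
    have r10 := hs.reg 10 (by decide)
    have r14 := hs.reg 14 (by decide)
    refine ⟨by simp [Expr.eval]; omega, Runs.of_run rfl (by decide) ?_⟩
    simp only [Prog.run, Prog.incr, Expr.eval, Mem.setReg_reg, Mem.setReg_arr, Mem.setArr_reg,
      Mem.setArr_arr, h1, h2, r10, hN, Nat.reduceEqDiff, if_true, if_false]
    refine ⟨trivial, by ring, fun c hc => ?_⟩
    rcases Nat.le_succ_iff.1 hc with hc | rfl
    · rw [Function.update_of_ne (by omega), h3 c hc]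
    · rw [Function.update_self]; simp [add_mul]
  · rintro μ' hs ⟨h1, h2⟩
    have r14 := hs.reg 14 (by decide)
    simp [Expr.eval]; omega

theorem prodCopy_runs {μ : Mem} {M : ℕ} (hM : μ.reg 11 = M) (h20 : μ.reg 20 = 0) :
    Runs prodCopy μ (M * 13 + 4) fun μ' => ∀ e < M, μ'.arr 18 e = μ.arr 2 e := by
  refine (Runs.loop M 8 (fun i μ' => μ'.reg 20 = i ∧ ∀ e < i, μ'.arr 18 e = μ.arr 2 e)
    (by simp [h20]) ?_ ?_).mono (by simp [Expr.cost]; omega) fun μ' h => h.2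
  · rintro i hi μ' hs ⟨h1, h2⟩
    have r11 := hs.reg 11 (by decide)
    have a2 := hs.arr 2 (by decide)
    refine ⟨by simp [Expr.eval]; omega, Runs.of_run rfl (by decide) ?_⟩
    simp only [Prog.run, Prog.incr, Expr.eval, Mem.setReg_reg, Mem.setReg_arr, Mem.setArr_reg,
      Mem.setArr_arr, h1, a2, if_true]
    refine ⟨trivial, fun x hx => ?_⟩
    rcases Nat.lt_succ_iff_lt_or_eq.1 hx with hx | rfl
    · simpa [hx.ne] using h2 x hx
    · simp
  · rintro μ' hs ⟨h1, h2⟩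
    have r11 := hs.reg 11 (by decide)
    simp [Expr.eval]; omega

/-- The edge arrays are overwritten while the old edges are still needed. The sources survive, since
level 0 has offset 0 and rewrites them unchanged. The ends may change already at level 0, by a jump,
and are therefore read from the copy in array 18. -/
theorem prodEdges_runs {μ : Mem} {N M L : ℕ} (hM : μ.reg 11 = M) (hL : μ.reg 14 = L)
    (hM0 : 0 < M) (h20 : μ.reg 20 = 0) (h25 : μ.reg 25 = 0) (h26 : μ.reg 26 = 0)
    (h17 : ∀ c ≤ L, μ.arr 17 c = c * N) (h18 : ∀ e < M, μ.arr 18 e = μ.arr 2 e)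
    (hhi : ∀ e < M, μ.arr 16 (μ.arr 14 (μ.arr 1 e)) < L) :
    Runs prodEdges μ (M * L * 60 + 4) fun μ' => μ'.reg 20 = M * L ∧ ∀ i < M * L,
      μ'.arr 1 i = μ.arr 1 (i % M) + i / M * N ∧
      μ'.arr 2 i = μ.arr 2 (i % M) + jump (μ.arr 15 (μ.arr 14 (μ.arr 1 (i % M))))
        (μ.arr 16 (μ.arr 14 (μ.arr 1 (i % M)))) (i / M) * N := by
  refine (Runs.loop (M * L) 56 (fun i μ' => μ'.reg 20 = i ∧ μ'.reg 25 = i % M ∧ μ'.reg 26 = i / M ∧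
    (∀ r < M, μ'.arr 1 r = μ.arr 1 r) ∧ ∀ j < i,
      μ'.arr 1 j = μ.arr 1 (j % M) + j / M * N ∧
      μ'.arr 2 j = μ.arr 2 (j % M) + jump (μ.arr 15 (μ.arr 14 (μ.arr 1 (j % M))))
        (μ.arr 16 (μ.arr 14 (μ.arr 1 (j % M)))) (j / M) * N)
    (by simp [h20, h25, h26]) ?_ ?_).mono (by simp [Expr.cost]) fun μ' h => ⟨h.1, h.2.2.2.2⟩
  · rintro i hi μ' hs ⟨h1, h2, h3, h4, h5⟩
    have r11 := (hs.reg 11 (by decide)).trans hM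
    have r14 := (hs.reg 14 (by decide)).trans hL
    have a14 := hs.arr 14 (by decide)
    have a15 := hs.arr 15 (by decide)
    have a16 := hs.arr 16 (by decide)
    have a17 := hs.arr 17 (by decide)
    have a18 := hs.arr 18 (by decide)
    have hr := Nat.mod_lt i hM0
    have hc : i / M < L := by rw [Nat.div_lt_iff_lt_mul hM0, mul_comm]; exact hi
    obtain ⟨hdiv, hmod⟩ := add_one_div_mod M i hM0
    refine ⟨by simp only [Expr.eval, h3, r14]; omega, ?_⟩
    refine (((Prog.runs rfl μ').mono (B' := 4) (by decide) fun _ h => h).seq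
      fun μ₁ s₁ e₁ => ?_).mono (B := 4 + 52) (by omega) fun _ h => h
    have g20 : μ₁.reg 20 = i := (s₁.reg 20 (by decide)).trans h1
    have g25 : μ₁.reg 25 = i % M := (s₁.reg 25 (by decide)).trans h2
    have g26 : μ₁.reg 26 = i / M := (s₁.reg 26 (by decide)).trans h3
    have g24 : μ₁.reg 24 = μ.arr 14 (μ.arr 1 (i % M)) := by
      simp [e₁, Prog.run, Expr.eval, a14, h2, h4 _ hr]
    have gg : μ₁.arr = μ'.arr := by simp [e₁, Prog.run]
    refine (Runs.seq (B := 13) (Q := fun μ₂ => μ₂.arr = μ'.arr ∧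
      μ₂.reg 27 = jump (μ.arr 15 (μ.arr 14 (μ.arr 1 (i % M))))
        (μ.arr 16 (μ.arr 14 (μ.arr 1 (i % M)))) (i / M)) ?_ fun μ₂ s₂ e₂ => ?_).mono
          (B := 13 + 39) (by omega) fun _ h => h
    · refine Runs.of_run rfl (by decide) ?_
      simp only [Prog.run, Expr.eval, gg, g24, a15, a16, g26, jump]
      split <;> simp [gg] <;> omega
    obtain ⟨e₂, e₂'⟩ := e₂
    have k20 : μ₂.reg 20 = i := (s₂.reg 20 (by decide)).trans g20
    have k25 : μ₂.reg 25 = i % M := (s₂.reg 25 (by decide)).trans g25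
    have k26 : μ₂.reg 26 = i / M := (s₂.reg 26 (by decide)).trans g26
    have k11 : μ₂.reg 11 = M := by rw [s₂.reg 11 (by decide), s₁.reg 11 (by decide), r11]
    have hjump : jump (μ.arr 15 (μ.arr 14 (μ.arr 1 (i % M))))
        (μ.arr 16 (μ.arr 14 (μ.arr 1 (i % M)))) (i / M) ≤ L := by
      unfold jump; split
      · exact (hhi _ hr).le
      · exact hc.le
    refine Runs.of_run rfl (by decide) ?_
    simp only [Prog.run, Prog.incr, Expr.eval, Mem.setReg_reg, Mem.setArr_reg,
      Mem.setArr_arr, k20, k25, k26, k11, e₂, e₂', h4 _ hr, a17, a18, h18 _ hr, h17 _ hc.le,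
      h17 _ hjump, Nat.reduceEqDiff, if_true, if_false, OfNat.ofNat_ne_one]
    have hval : ∀ μ'' : Mem, μ''.arr 1 = Function.update (μ'.arr 1) i (μ.arr 1 (i % M) + i / M * N) →
        μ''.arr 2 = Function.update (μ'.arr 2) i (μ.arr 2 (i % M) +
          jump (μ.arr 15 (μ.arr 14 (μ.arr 1 (i % M))))
            (μ.arr 16 (μ.arr 14 (μ.arr 1 (i % M)))) (i / M) * N) →
        (∀ r < M, μ''.arr 1 r = μ.arr 1 r) ∧ ∀ j < i + 1,
      μ''.arr 1 j = μ.arr 1 (j % M) + j / M * N ∧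
      μ''.arr 2 j = μ.arr 2 (j % M) + jump (μ.arr 15 (μ.arr 14 (μ.arr 1 (j % M))))
        (μ.arr 16 (μ.arr 14 (μ.arr 1 (j % M)))) (j / M) * N := by
      intro μ'' e1 e2
      rw [e1, e2]
      refine ⟨fun r hr' => ?_, fun j hj => ?_⟩
      · by_cases hri : r = i
        · subst hri
          simp [Nat.mod_eq_of_lt hr', Nat.div_eq_of_lt hr']
        · rw [Function.update_of_ne hri, h4 r hr']
      · rcases Nat.lt_succ_iff_lt_or_eq.1 hj with hj | rfl
        · simpa [hj.ne] using h5 j hj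
        · simp
    by_cases hlt : i % M + 1 < M
    · rw [if_neg (by omega), hdiv, hmod, if_pos hlt, if_pos hlt]
      refine ⟨?_, ?_, ?_, hval _ ?_ ?_⟩ <;> simp [k26, e₂]
    · rw [if_pos (by omega), hdiv, hmod, if_neg hlt, if_neg hlt]
      refine ⟨?_, ?_, ?_, hval _ ?_ ?_⟩ <;> simp [e₂]
  · rintro μ' hs ⟨h1, h2, h3, -⟩
    have r14 := (hs.reg 14 (by decide)).trans hL
    simp [Expr.eval, h3, r14, Nat.mul_div_cancel_left _ hM0]

/-- Level 0 is already in place. Starting at `N`, each entry is copied from the one `N` places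
earlier, so no remainders are computed. -/
theorem prodVertices_runs {μ : Mem} {N L : ℕ} (hN : μ.reg 10 = N) (hL : μ.reg 14 = L)
    (hN0 : 0 < N) (hL0 : 0 < L) (h20 : μ.reg 20 = N) (h17 : μ.arr 17 L = L * N) :
    Runs prodVertices μ (N * L * 24 + 5) fun μ' => ∀ x < N * L,
      μ'.arr 0 x = μ.arr 0 (x % N) ∧ μ'.arr 14 x = μ.arr 14 (x % N) := by
  have hle : N ≤ N * L := Nat.le_mul_of_pos_right _ hL0
  refine (Runs.loop (N * L - N) 18 (fun i μ' => μ'.reg 20 = N + i ∧ ∀ x < N + i,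
      μ'.arr 0 x = μ.arr 0 (x % N) ∧ μ'.arr 14 x = μ.arr 14 (x % N))
    ⟨h20, fun x hx => by rw [add_zero] at hx; rw [Nat.mod_eq_of_lt hx]; simp⟩ ?_ ?_).mono
      (by simp [Expr.cost]; omega) fun μ' h => ?_
  · rintro i hi μ' hs ⟨h1, h2⟩
    have r10 := (hs.reg 10 (by decide)).trans hN
    have r14 := (hs.reg 14 (by decide)).trans hL
    have a17 := hs.arr 17 (by decide)
    refine ⟨by simp [Expr.eval, r14, a17, h17, h1, mul_comm L]; omega, Runs.of_run rfl (by decide) ?_⟩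
    simp only [Prog.run, Prog.incr, Expr.eval, Mem.setReg_reg, Mem.setReg_arr, Mem.setArr_reg,
      Mem.setArr_arr, h1, r10, if_true, if_false, OfNat.ofNat_ne_zero,
      OfNat.zero_ne_ofNat, Nat.add_sub_cancel_left]
    refine ⟨by omega, fun x hx => ?_⟩
    by_cases hx' : x = N + i
    · subst hx'
      simp [h2 i (by omega)]
    · rw [Function.update_of_ne hx', Function.update_of_ne hx']
      exact h2 x (by omega)
  · rintro μ' hs ⟨h1, h2⟩
    have r14 := (hs.reg 14 (by decide)).trans hL
    have a17 := hs.arr 17 (by decide)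
    simp [Expr.eval, r14, a17, h17, h1, mul_comm L]; omega
  · rw [Nat.add_sub_cancel' hle] at h
    exact h.2

theorem prodProg_runs {μ : Mem} {N M L : ℕ} (hN : μ.reg 10 = N) (hM : μ.reg 11 = M)
    (hL : μ.reg 14 = L) (hN0 : 0 < N) (hM0 : 0 < M) (hL0 : 0 < L)
    (hhi : ∀ e < M, μ.arr 16 (μ.arr 14 (μ.arr 1 e)) < L) :
    Runs prodProg μ ((N + M) * L * 150) fun μ' => μ'.reg 10 = N * L ∧ μ'.reg 11 = M * L ∧
      (∀ i < M * L, μ'.arr 1 i = μ.arr 1 (i % M) + i / M * N ∧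
        μ'.arr 2 i = μ.arr 2 (i % M) + jump (μ.arr 15 (μ.arr 14 (μ.arr 1 (i % M))))
          (μ.arr 16 (μ.arr 14 (μ.arr 1 (i % M)))) (i / M) * N) ∧
      ∀ x < N * L, μ'.arr 0 x = μ.arr 0 (x % N) ∧ μ'.arr 14 x = μ.arr 14 (x % N) := by
  refine (((Prog.runs rfl μ).mono (B' := 7) (by decide) fun _ h => h).seq fun μ₁ s₁ h₁ => ?_).mono
    (B := 7 + (L * 20 + 4 + (2 + (M * 13 + 4 + (6 + (M * L * 60 + 4 +
      (4 + (N * L * 24 + 5 + 3)))))))) (by nlinarith) fun _ h => h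
  refine (prodOffsets_runs (N := N) (L := L) ((s₁.reg 10 (by decide)).trans hN)
    ((s₁.reg 14 (by decide)).trans hL) ?_ ?_ ?_).seq fun μ₂ s₂ h₂ => ?_
  iterate 3 · simp [h₁, Prog.run, Expr.eval]
  refine ((Prog.runs rfl μ₂).mono (by decide) fun _ h => h).seq fun μ₃ s₃ h₃ => ?_
  refine (prodCopy_runs (M := M) ?_ ?_).seq fun μ₄ s₄ h₄ => ?_
  · rw [s₃.reg 11 (by decide), s₂.reg 11 (by decide), s₁.reg 11 (by decide), hM]
  · simp [h₃, Prog.run, Expr.eval]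
  refine ((Prog.runs rfl μ₄).mono (by decide) fun _ h => h).seq fun μ₅ s₅ h₅ => ?_
  have a {k : ℕ} (hk : k ∈ [0, 1, 2, 14, 15, 16]) : μ₅.arr k = μ.arr k := by
    simp only [List.mem_cons, List.not_mem_nil, or_false] at hk
    rcases hk with rfl | rfl | rfl | rfl | rfl | rfl <;>
    rw [s₅.arr _ (by decide), s₄.arr _ (by decide), s₃.arr _ (by decide), s₂.arr _ (by decide),
      s₁.arr _ (by decide)]
  have r {k : ℕ} (hk : k ∈ [10, 11, 14]) : μ₅.reg k = μ.reg k := by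
    simp only [List.mem_cons, List.not_mem_nil, or_false] at hk
    rcases hk with rfl | rfl | rfl <;>
    rw [s₅.reg _ (by decide), s₄.reg _ (by decide), s₃.reg _ (by decide), s₂.reg _ (by decide),
      s₁.reg _ (by decide)]
  have a17 : ∀ c ≤ L, μ₅.arr 17 c = c * N := by
    rwa [s₅.arr _ (by decide), s₄.arr _ (by decide), s₃.arr _ (by decide)]
  have b2 : μ₃.arr 2 = μ.arr 2 := by
    rw [s₃.arr _ (by decide), s₂.arr _ (by decide), s₁.arr _ (by decide)]
  refine (prodEdges_runs (N := N) (M := M) (L := L) ((r (by simp)).trans hM)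
    ((r (by simp)).trans hL) hM0 ?_ ?_ ?_ a17 ?_ ?_).seq fun μ₆ s₆ h₆ => ?_
  iterate 3 · simp [h₅, Prog.run, Expr.eval]
  · rwa [s₅.arr _ (by decide), a (by simp), ← b2]
  · rwa [a (by simp), a (by simp), a (by simp)]
  rw [a (k := 1) (by simp), a (k := 2) (by simp), a (k := 14) (by simp), a (k := 15) (by simp),
    a (k := 16) (by simp)] at h₆
  refine ((Prog.runs rfl μ₆).mono (by decide) fun _ h => h).seq fun μ₇ s₇ h₇ => ?_
  have b17 : μ₇.arr 17 L = L * N := by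
    rw [s₇.arr _ (by decide), s₆.arr _ (by decide), a17 L le_rfl]
  have q10 : μ₇.reg 10 = N := by
    rw [s₇.reg _ (by decide), s₆.reg _ (by decide), r (by simp), hN]
  have q14 : μ₇.reg 14 = L := by
    rw [s₇.reg _ (by decide), s₆.reg _ (by decide), r (by simp), hL]
  refine (prodVertices_runs q10 q14 hN0 hL0 ?_ b17).seq fun μ₈ s₈ h₈ => ?_
  · simp [h₇, Prog.run, Expr.eval, s₆.reg 10 (by decide), r, hN]
  rw [s₇.arr _ (by decide), s₇.arr _ (by decide), s₆.arr _ (by decide), s₆.arr _ (by decide),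
    a (by simp), a (by simp)] at h₈
  refine Runs.of_run rfl (by decide) ?_
  simp only [Prog.run, Expr.eval, Mem.setReg_reg, Mem.setReg_arr, Nat.reduceEqDiff, if_true,
    if_false]
  refine ⟨?_, ?_, ?_, h₈⟩
  · rw [s₈.reg 14 (by decide), q14, s₈.arr 17 (by decide), b17, mul_comm]
  · rw [s₈.reg 11 (by decide), h₇]
    simp [Prog.run, Expr.eval, h₆.1]
  · rw [s₈.arr _ (by decide), s₈.arr _ (by decide), s₇.arr _ (by decide), s₇.arr _ (by decide)]
    exact h₆.2

/-! ### Games as attractors -/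

section Hist

variable {V : Type*}

/-- Eve can force a visit to `T` from `v`. -/
abbrev Arena.Force (A : Arena V) (T : V → Prop) : V → Prop :=
  Attr (fun v w => (v, w) ∈ A.edges) (A.owner · = .eve) T

/-- Eve wins from the vertex `x.1` after the vertices in `x.2` have been visited. -/
abbrev Game.Wins (G : Game V) : V × Set V → Prop :=
  Attr (fun x y => (x.1, y.1) ∈ G.arena.edges ∧ y.2 = insert x.1 x.2)
    (fun x => G.arena.owner x.1 = .eve) fun x => ∀ X, G.IsTarget X → ∃ u ∈ X, u ∈ x.2

/-- The positions from which Eve can force a visit to `T` within `n` moves. -/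
def attrWithin {X : Type*} (E : X → X → Prop) (eve : X → Prop) (T : X → Prop) : ℕ → X → Prop
  | 0 => T
  | n + 1 => fun x => attrWithin E eve T n x ∨ (eve x ∧ ∃ y, E x y ∧ attrWithin E eve T n y) ∨
      (¬ eve x ∧ ∀ y, E x y → attrWithin E eve T n y)

theorem attrWithin_mono {X : Type*} {E : X → X → Prop} {eve T : X → Prop} {x : X} :
    Monotone fun n => attrWithin E eve T n x :=
  monotone_nat_of_le_succ fun _ h => .inl h

/-- Finite branching keeps the ranks finite: at a position of Adam the ranks of the successors have
a maximum. -/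
theorem Attr.exists_within {X : Type*} {E : X → X → Prop} {eve T : X → Prop} {x : X}
    (hfin : ∀ x, {y | E x y}.Finite) (h : Attr E eve T x) : ∃ n, attrWithin E eve T n x := by
  induction h with
  | base h => exact ⟨0, h⟩
  | eve hx hE _ ih =>
    obtain ⟨n, hn⟩ := ih
    exact ⟨n + 1, .inr (.inl ⟨hx, _, hE, hn⟩)⟩
  | @adam x hx _ ih =>
    choose! f hf using ih
    obtain ⟨n, hn⟩ := ((hfin x).image f).bddAbove
    exact ⟨n + 1, .inr (.inr ⟨hx, fun y hy =>
      attrWithin_mono (hn (Set.mem_image_of_mem f hy)) (hf y hy)⟩)⟩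

/-- The situation after `i` moves: the current vertex and the set of the earlier ones. -/
def Arena.pos (A : Arena V) (σ : Strategy A .eve) (τ : Strategy A .adam) (s : V) (i : ℕ) :
    V × Set V :=
  ((A.playAux σ τ s i).2, {u | u ∈ (A.playAux σ τ s i).1})

theorem Arena.pos_succ (A : Arena V) (σ : Strategy A .eve) (τ : Strategy A .adam) (s : V) (i : ℕ) :
    A.pos σ τ s (i + 1) = (A.next σ τ (A.playAux σ τ s i).1 (A.playAux σ τ s i).2,
      insert (A.pos σ τ s i).1 (A.pos σ τ s i).2) := by
  ext u
  · rfl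
  · simp [Arena.pos, Arena.playAux, or_comm]

theorem Arena.mem_pos (A : Arena V) (σ : Strategy A .eve) (τ : Strategy A .adam) (s : V) (i : ℕ)
    (u : V) : u ∈ (A.pos σ τ s i).2 ↔ ∃ j < i, A.play σ τ s j = u := by
  induction i with
  | zero => simp [Arena.pos, Arena.playAux]
  | succ i ih =>
    rw [Arena.pos_succ, Set.mem_insert_iff, ih]
    simp only [Nat.lt_succ_iff_lt_or_eq, or_and_right, exists_or, exists_eq_left]
    rw [or_comm, eq_comm (a := u)]; rfl

theorem Arena.next_mem (A : Arena V) (σ : Strategy A .eve) (τ : Strategy A .adam) (h : List V)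
    (v : V) : (v, A.next σ τ h v) ∈ A.edges := by
  unfold Arena.next
  split
  · exact σ.legal h ⟨v, _⟩
  · exact τ.legal h ⟨v, _⟩

theorem Arena.next_eve (A : Arena V) (σ : Strategy A .eve) (τ : Strategy A .adam) (h : List V)
    {v : V} (hv : A.owner v = .eve) : A.next σ τ h v = σ.move h ⟨v, hv⟩ := by
  unfold Arena.next
  split
  · rfl
  · next h' => exact absurd (hv.symm.trans h') (by simp)

theorem Arena.next_adam (A : Arena V) (σ : Strategy A .eve) (τ : Strategy A .adam) (h : List V)
    {v : V} (hv : A.owner v = .adam) : A.next σ τ h v = τ.move h ⟨v, hv⟩ := by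
  unfold Arena.next
  split
  · next h' => exact absurd (hv.symm.trans h') (by simp)
  · rfl

theorem Player.ne_eve {p : Player} : p ≠ .eve ↔ p = .adam := by cases p <;> simp

/-- Moves to successors that satisfy a given relation to the history, where there are any. -/
theorem Arena.exists_strategy (A : Arena V) (p : Player) (R : List V → V → V → Prop) :
    ∃ σ : Strategy A p, ∀ h v, (∃ w, (v.1, w) ∈ A.edges ∧ R h v.1 w) → R h v.1 (σ.move h v) := by
  have : ∀ (h : List V) (v : V), ∃ w, (v, w) ∈ A.edges ∧
      ((∃ w, (v, w) ∈ A.edges ∧ R h v w) → R h v w) := fun h v => by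
    by_cases hv : ∃ w, (v, w) ∈ A.edges ∧ R h v w
    · obtain ⟨w, hw, hR⟩ := hv
      exact ⟨w, hw, fun _ => hR⟩
    · obtain ⟨w, hw⟩ := A.exists_succ v
      exact ⟨w, hw, fun h' => absurd h' hv⟩
  choose f hf hR using this
  exact ⟨⟨fun h v => f h v, fun h v => hf h v⟩, fun h v => hR h v⟩

/-! ### Strategies and attractors. -/

/-- Outside the attractor, Adam always has a move that stays outside and Eve has none that leaves.
Against such an Adam no target position ever occurs. -/
theorem Game.wins_of_eveWins {G : Game V} (h : G.EveWins) : G.Wins (G.start, ∅) := by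
  by_contra hn
  obtain ⟨σ, hσ⟩ := h
  obtain ⟨τ, hτ⟩ := G.arena.exists_strategy .adam fun h v w => ¬ G.Wins (w, insert v {u | u ∈ h})
  have key : ∀ i, ¬ G.Wins (G.arena.pos σ τ G.start i) := by
    intro i
    induction i with
    | zero => simpa [Arena.pos, Arena.playAux] using hn
    | succ i ih =>
      rw [Arena.pos_succ]
      by_cases ho : G.arena.owner (G.arena.playAux σ τ G.start i).2 = .eve
      · exact fun h => ih (.eve ho ⟨G.arena.next_mem σ τ _ _, rfl⟩ h)
      · rw [G.arena.next_adam _ _ _ (Player.ne_eve.1 ho)]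
        refine hτ _ ⟨_, _⟩ ?_
        by_contra! hc
        exact ih (.adam ho fun y hy => by
          obtain ⟨w, D⟩ := y
          obtain ⟨h1, rfl⟩ := hy
          exact hc w h1)
  obtain ⟨l, hl⟩ := hσ τ
  -- The second component contains only vertices that have been left, so the visit at time `l` shows
  -- at time `l + 1`.
  refine key (l + 1) (.base fun X hX => ?_)
  obtain ⟨j, hj, hjX⟩ := hl X hX
  exact ⟨_, hjX, (Arena.mem_pos ..).2 ⟨j, by omega, rfl⟩⟩

/-- Eve moves to a successor of least rank. The relation given to `exists_strategy` says this for
all ranks at once: whenever some successor is within `n` moves, the chosen one is. The rank then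
decreases along every play until a target position is reached. -/
theorem Game.eveWins_of_wins {G : Game V} (h : G.Wins (G.start, ∅)) : G.EveWins := by
  let W := attrWithin (X := V × Set V)
    (fun x y => (x.1, y.1) ∈ G.arena.edges ∧ y.2 = insert x.1 x.2)
    (fun x => G.arena.owner x.1 = .eve) (fun x => ∀ X, G.IsTarget X → ∃ u ∈ X, u ∈ x.2)
  obtain ⟨σ, hσ⟩ := G.arena.exists_strategy .eve fun h v w =>
    ∀ n w', (v, w') ∈ G.arena.edges → W n (w', insert v {u | u ∈ h}) → W n (w, insert v {u | u ∈ h})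
  refine ⟨σ, fun τ => ?_⟩
  have best : ∀ (h : List V) (v : V), ∃ w, (v, w) ∈ G.arena.edges ∧ ∀ n w',
      (v, w') ∈ G.arena.edges → W n (w', insert v {u | u ∈ h}) →
        W n (w, insert v {u | u ∈ h}) := by
    intro h v
    by_cases hex : ∃ n, ∃ w, (v, w) ∈ G.arena.edges ∧ W n (w, insert v {u | u ∈ h})
    · classical
      obtain ⟨w, hw, hwn⟩ := Nat.find_spec hex
      exact ⟨w, hw, fun n w' hw' hn =>
        attrWithin_mono (Nat.find_min' hex ⟨w', hw', hn⟩) hwn⟩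
    · obtain ⟨w, hw⟩ := G.arena.exists_succ v
      exact ⟨w, hw, fun n w' hw' hn => absurd ⟨n, w', hw', hn⟩ hex⟩
  have key : ∀ n i, W n (G.arena.pos σ τ G.start i) →
      ∃ j, ∀ X, G.IsTarget X → ∃ u ∈ X, u ∈ (G.arena.pos σ τ G.start j).2 := by
    intro n
    induction n with
    | zero => exact fun i hi => ⟨i, hi⟩
    | succ n ih =>
      rintro i (hi | ⟨ho, ⟨w, D⟩, ⟨hE, hD⟩, hi⟩ | ⟨ho, hi⟩)
      · exact ih i hi
      · refine ih (i + 1) ?_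
        simp only at hD
        subst hD
        change G.arena.owner (G.arena.playAux σ τ G.start i).2 = .eve at ho
        rw [Arena.pos_succ, G.arena.next_eve _ _ _ ho]
        exact hσ _ ⟨_, ho⟩ (best _ _) n w hE hi
      · refine ih (i + 1) (hi _ ?_)
        rw [Arena.pos_succ]
        exact ⟨G.arena.next_mem σ τ _ _, rfl⟩
  obtain ⟨n, hn⟩ := h.exists_within fun x => by
    refine ((G.arena.edges.finite_toSet.image Prod.snd).image (·, insert x.1 x.2)).subset ?_
    rintro ⟨w, D⟩ ⟨h1, h2⟩
    exact ⟨w, ⟨_, h1, rfl⟩, by simp [← h2]⟩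
  obtain ⟨j, hj⟩ := key n 0 (by simpa [Arena.pos, Arena.playAux] using hn)
  refine ⟨j, fun X hX => ?_⟩
  obtain ⟨u, hu, hu'⟩ := hj X hX
  obtain ⟨i, hi, rfl⟩ := (Arena.mem_pos ..).1 hu'
  exact ⟨i, hi.le, hu⟩

theorem Game.eveWins_iff {G : Game V} : G.EveWins ↔ G.Wins (G.start, ∅) :=
  ⟨G.wins_of_eveWins, G.eveWins_of_wins⟩

end Hist

/-! ### Monitors -/

section Monitor

variable {V : Type*} (G : Game V)

/-- From the singleton target `t`, Eve can force a visit to `t'`. -/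
def Game.le (t t' : V) : Prop := G.arena.Force (· = t') t

open scoped Classical in
/-- The number of singleton targets from which Eve can force a visit to `t`. -/
noncomputable def Game.height (t : V) : ℕ := (G.singles.filter (G.le · t)).card

open scoped Classical in
/-- The number of singleton targets of smaller height. -/
noncomputable def Game.lower (t : V) : ℕ :=
  (G.singles.filter fun t' => G.height t' < G.height t).card

/-- The product with monitors for the target sets. The monitor with index `0` is for the singletons,
the one with index `i + 1` is for the set `mem i`; they read the vertices that are left. -/
abbrev Game.MonitorWins (lo hi : ℕ → V → ℕ) (L : ℕ → ℕ) (k : ℕ) : V × (ℕ → ℕ) → Prop :=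
  Attr (fun x y => (x.1, y.1) ∈ G.arena.edges ∧
      y.2 = fun i => jump (lo i x.1) (hi i x.1) (x.2 i))
    (fun x => G.arena.owner x.1 = .eve) fun x => ∀ i ≤ k, x.2 i + 1 = L i

open scoped Classical in
/-- The levels at which the monitors jump. -/
noncomputable def Game.lo (mem : ℕ → V → Prop) : ℕ → V → ℕ
  | 0, v => if v ∈ G.singles ∧ G.lower v < G.height v then G.lower v else G.singles.card + 1
  | i + 1, v => if mem i v then 0 else 2

open scoped Classical in
/-- The levels to which the monitors jump. -/
noncomputable def Game.hi : ℕ → V → ℕ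
  | 0, v => if v ∈ G.singles then G.height v else 0
  | _ + 1, _ => 1

/-- The numbers of levels of the monitors. -/
def Game.levels : ℕ → ℕ
  | 0 => G.singles.card + 1
  | _ + 1 => 2

variable {G}

theorem jump_self (l h : ℕ) : jump l h l = h := if_pos rfl

theorem jump_of_ne {l c : ℕ} (h : ℕ) (hc : l ≠ c) : jump l h c = c := if_neg hc

theorem Game.lo_zero_of_mem (mem : ℕ → V → Prop) {v : V} (hv : v ∈ G.singles)
    (h : G.lower v < G.height v) : G.lo mem 0 v = G.lower v := if_pos ⟨hv, h⟩

theorem Game.lo_zero_of_not (mem : ℕ → V → Prop) {v : V}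
    (h : ¬ (v ∈ G.singles ∧ G.lower v < G.height v)) : G.lo mem 0 v = G.singles.card + 1 :=
  if_neg h

theorem Game.lo_succ_of_mem {mem : ℕ → V → Prop} {i : ℕ} {v : V} (h : mem i v) :
    G.lo mem (i + 1) v = 0 := if_pos h

theorem Game.lo_succ_of_not {mem : ℕ → V → Prop} {i : ℕ} {v : V} (h : ¬ mem i v) :
    G.lo mem (i + 1) v = 2 := if_neg h

theorem Game.hi_zero_of_mem {v : V} (hv : v ∈ G.singles) : G.hi 0 v = G.height v := if_pos hv

theorem Game.hi_succ (i : ℕ) (v : V) : G.hi (i + 1) v = 1 := rfl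

/-! ### The preorder of forced visits and tours through its classes. -/

theorem Game.le_refl (t : V) : G.le t t := .base rfl

theorem Attr.trans {X : Type*} {E : X → X → Prop} {eve T T' : X → Prop} {x : X}
    (h : Attr E eve T x) (h' : ∀ y, T y → Attr E eve T' y) : Attr E eve T' x := by
  induction h with
  | base h => exact h' _ h
  | eve hx hE _ ih => exact .eve hx hE ih
  | adam hx _ ih => exact .adam hx ih

theorem Game.le_trans {t t' t'' : V} (h : G.le t t') (h' : G.le t' t'') : G.le t t'' :=
  Attr.trans h fun y hy => by subst hy; exact h'

theorem Game.height_mono {t t' : V} (h : G.le t t') : G.height t ≤ G.height t' := by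
  classical
  exact Finset.card_le_card (Finset.monotone_filter_right _ fun u _ hu => G.le_trans hu h)

theorem Game.height_pos {t : V} (h : t ∈ G.singles) : 0 < G.height t := by
  classical
  exact Finset.card_pos.2 ⟨t, by simp [h, G.le_refl]⟩

theorem Game.height_le (t : V) : G.height t ≤ G.singles.card := by
  classical
  exact Finset.card_filter_le _ _

/-- A forced visit, as a part of a play. -/
theorem Game.Wins.of_force {T : V → Prop} {v : V} (h : G.arena.Force T v) :
    ∀ D : Set V, (∀ t D', T t → D ⊆ D' → (T v ∨ v ∈ D') → G.Wins (t, D')) → G.Wins (v, D) := by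
  induction h with
  | base h => exact fun D hD => hD _ _ h subset_rfl (.inl h)
  | @eve v w hv hE _ ih =>
    refine fun D hD => .eve hv (y := (w, insert v D)) ⟨hE, rfl⟩ (ih _ fun t D' ht hs _ => ?_)
    exact hD t D' ht ((Set.subset_insert _ _).trans hs) (.inr (hs (Set.mem_insert _ _)))
  | @adam v hv _ ih =>
    refine fun D hD => .adam hv ?_
    rintro ⟨w, _⟩ ⟨hE, rfl⟩
    refine ih w hE _ fun t D' ht hs _ => ?_
    exact hD t D' ht ((Set.subset_insert _ _).trans hs) (.inr (hs (Set.mem_insert _ _)))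

/-- Eve can make a tour through vertices of one strongly connected class. -/
theorem Game.Wins.tour {v : V} (A : Finset V) (hA : ∀ t ∈ A, G.le v t ∧ G.le t v) :
    ∀ D : Set V, (∀ D', D ⊆ D' → (∀ t ∈ A, t = v ∨ t ∈ D') → G.Wins (v, D')) → G.Wins (v, D) := by
  classical
  induction A using Finset.induction_on with
  | empty => exact fun D h => h D subset_rfl (by simp)
  | insert a A _ ih =>
    -- After the tour through the other vertices Eve goes to `a` and back to `v`; leaving `a`
    -- records it as visited, unless `a = v`.
    refine fun D h => ih (fun t ht => hA t (Finset.mem_insert_of_mem ht)) D fun D₁ h₁ hA₁ => ?_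
    obtain ⟨hva, hav⟩ := hA a (Finset.mem_insert_self _ _)
    refine .of_force hva _ ?_
    rintro _ D₂ rfl h₂ -
    refine .of_force hav _ ?_
    rintro _ D₃ rfl h₃ h'
    refine h D₃ (h₁.trans (h₂.trans h₃)) fun t ht => ?_
    rcases Finset.mem_insert.1 ht with rfl | ht
    · exact h'
    · exact (hA₁ t ht).imp id fun h => h₃ (h₂ h)

open scoped Classical in
/-- The number of visited singleton targets whose height is at most `c`. -/
noncomputable def Game.visited (G : Game V) (D : Set V) (c : ℕ) : ℕ :=
  (G.singles.filter fun t => t ∈ D ∧ G.height t ≤ c).card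

theorem Game.visited_mono {D D' : Set V} (h : D ⊆ D') (c : ℕ) :
    G.visited D c ≤ G.visited D' c := by
  classical
  exact Finset.card_le_card (Finset.monotone_filter_right _ fun u _ hu => ⟨h hu.1, hu.2⟩)

/-- A singleton below `v` has smaller height or the same down-set as `v`, and in the latter case is
equivalent to `v`. So `height v` is at most `lower v` plus the size of the class of `v`. The visited
singletons of height at most `lower v` number at least `lower v`, and they are disjoint from this
class since `lower v < height v`. -/
theorem Game.height_le_visited {v : V} (hv : v ∈ G.singles) (hlt : G.lower v < G.height v)
    {D : Set V} (hD : G.lower v ≤ G.visited D (G.lower v))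
    (hc : ∀ t ∈ G.singles, G.le v t → G.le t v → t ∈ D) :
    G.height v ≤ G.visited D (G.height v) := by
  classical
  set A := G.singles.filter fun t => t ∈ D ∧ G.height t ≤ G.lower v
  set B := G.singles.filter fun t => G.le v t ∧ G.le t v
  have hB : G.height v ≤ G.lower v + B.card := by
    refine (Finset.card_le_card ?_).trans (Finset.card_union_le _ _)
    intro t ht
    simp only [Finset.mem_filter, Finset.mem_union, B] at ht ⊢
    by_cases hvt : G.height t < G.height v
    · exact .inl ⟨ht.1, hvt⟩
    · refine .inr ⟨ht.1, ?_, ht.2⟩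
      have heq := Finset.eq_of_subset_of_card_le
        (Finset.monotone_filter_right (p := (G.le · t)) (q := (G.le · v)) G.singles
          fun u _ hu => G.le_trans hu ht.2) (not_lt.1 hvt)
      have hmem : v ∈ G.singles.filter (G.le · t) := by
        rw [heq]; simp [hv, G.le_refl]
      exact (Finset.mem_filter.1 hmem).2
  have hdisj : Disjoint A B := by
    rw [Finset.disjoint_left]
    intro t htA htB
    simp only [Finset.mem_filter, A, B] at htA htB
    have := G.height_mono htB.2.1
    omega
  calc G.height v ≤ A.card + B.card := hB.trans (Nat.add_le_add_right hD _)
    _ = (A ∪ B).card := (Finset.card_union_of_disjoint hdisj).symm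
    _ ≤ _ := Finset.card_le_card fun t ht => by
      simp only [Finset.mem_filter, Finset.mem_union, A, B] at ht ⊢
      rcases ht with ⟨h1, h2, h3⟩ | ⟨h1, h2, h3⟩
      · exact ⟨h1, h2, by omega⟩
      · exact ⟨h1, hc t h1 h2 h3, G.height_mono h3⟩

/-- Winning the product with the monitors suffices. -/
theorem Game.MonitorWins.wins {mem : ℕ → V → Prop} {k : ℕ}
    (hmem : ∀ D : Set V, (∀ X ∈ G.sets, ∃ u ∈ X, u ∈ D) ↔ ∀ i < k, ∃ u ∈ D, mem i u)
    {x : V × (ℕ → ℕ)} (h : G.MonitorWins (G.lo mem) G.hi G.levels k x) :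
    ∀ D : Set V, (∀ i, x.2 (i + 1) ≠ 0 → ∃ u ∈ D, mem i u) → x.2 0 ≤ G.visited D (x.2 0) →
      G.Wins (x.1, D) := by
  classical
  have hstep : ∀ (v : V) (q : ℕ → ℕ) (D : Set V), (∀ i, q (i + 1) ≠ 0 → ∃ u ∈ D, mem i u) →
      ∀ i, jump (G.lo mem (i + 1) v) (G.hi (i + 1) v) (q (i + 1)) ≠ 0 →
        ∃ u ∈ insert v D, mem i u := by
    intro v q D hD i hi
    by_cases hq : q (i + 1) = 0
    · by_cases hv : mem i v
      · exact ⟨v, Set.mem_insert _ _, hv⟩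
      · rw [G.lo_succ_of_not hv, jump_of_ne _ (by omega)] at hi
        exact absurd hq hi
    · obtain ⟨u, hu, hu'⟩ := hD i hq
      exact ⟨u, Set.mem_insert_of_mem _ hu, hu'⟩
  -- If the counter is about to jump at `v`, Eve first makes the tour through the class of `v`;
  -- leaving `v` then restores the bound on the level by visited singletons.
  have htour : ∀ (v : V) (q : ℕ → ℕ) (D : Set V), q 0 ≤ G.visited D (q 0) →
      (∀ D', D ⊆ D' → jump (G.lo mem 0 v) (G.hi 0 v) (q 0) ≤
        G.visited (insert v D') (jump (G.lo mem 0 v) (G.hi 0 v) (q 0)) → G.Wins (v, D')) →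
      G.Wins (v, D) := by
    intro v q D hD h
    by_cases hj : v ∈ G.singles ∧ G.lower v < G.height v ∧ G.lower v = q 0
    · obtain ⟨hv, hlt, heq⟩ := hj
      refine .tour (G.singles.filter fun t => G.le v t ∧ G.le t v) (by simp) _ fun D' hs hD' => ?_
      refine h D' hs ?_
      rw [show jump (G.lo mem 0 v) (G.hi 0 v) (q 0) = G.height v by
        rw [G.lo_zero_of_mem mem hv hlt, heq, jump_self, G.hi_zero_of_mem hv]]
      refine G.height_le_visited hv hlt ?_ fun t ht h1 h2 => ?_
      · rw [heq]
        exact hD.trans (G.visited_mono (hs.trans (Set.subset_insert _ _)) _)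
      · exact hD' t (by simp [ht, h1, h2])
    · refine h D subset_rfl ?_
      rw [show jump (G.lo mem 0 v) (G.hi 0 v) (q 0) = q 0 from ?_]
      · exact hD.trans (G.visited_mono (Set.subset_insert _ _) _)
      -- Labels without a jump carry the level n + 1, which the counter never reaches.
      · have hle : q 0 ≤ G.singles.card := hD.trans (Finset.card_filter_le _ _)
        refine jump_of_ne _ fun hc => ?_
        by_cases h' : v ∈ G.singles ∧ G.lower v < G.height v
        · rw [G.lo_zero_of_mem mem h'.1 h'.2] at hc
          exact hj ⟨h'.1, h'.2, hc⟩
        · rw [G.lo_zero_of_not mem h'] at hc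
          omega
  induction h with
  | @base x hx =>
    intro D h1 h2
    refine .base ?_
    rintro X (hX | ⟨t, ht, rfl⟩)
    · refine (hmem D).2 (fun i hi => h1 i ?_) X hX
      have := hx (i + 1) hi
      simp only [Game.levels] at this
      omega
    · refine ⟨t, by simp, ?_⟩
      -- At level n the bound counts n visited singletons, which are all of them.
      have h0 : x.2 0 = G.singles.card := by simpa [Game.levels] using hx 0 (Nat.zero_le _)
      rw [h0] at h2
      have := Finset.eq_of_subset_of_card_le (Finset.filter_subset _ _) h2
      rw [← this] at ht
      exact (Finset.mem_filter.1 ht).2.1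
  | @eve x y hx hE _ ih =>
    intro D h1 h2
    refine htour x.1 x.2 D h2 fun D' hs h3 => ?_
    refine .eve hx (y := (y.1, insert x.1 D')) ⟨hE.1, rfl⟩ (ih _ ?_ ?_)
    · rw [hE.2]
      exact hstep _ _ _ fun i hi => (h1 i hi).imp fun u hu => ⟨hs hu.1, hu.2⟩
    · rw [hE.2]; exact h3
  | @adam x hx _ ih =>
    intro D h1 h2
    refine htour x.1 x.2 D h2 fun D' hs h3 => ?_
    refine .adam hx ?_
    rintro ⟨w, _⟩ ⟨hE, rfl⟩
    refine ih (w, fun i => jump (G.lo mem i x.1) (G.hi i x.1) (x.2 i)) ⟨hE, rfl⟩ _ ?_ h3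
    exact hstep _ _ _ fun i hi => (h1 i hi).imp fun u hu => ⟨hs hu.1, hu.2⟩

/-- From a winning position an unvisited `t` has to be met. The winning derivation, cut off at `t`,
forces that visit. -/
theorem Game.Wins.le {t : V} (ht : t ∈ G.singles) {x : V × Set V} (h : G.Wins x)
    (hx : t ∉ x.2) : G.le x.1 t := by
  induction h with
  | base h =>
    obtain ⟨u, hu, hu'⟩ := h {t} (.inr ⟨t, ht, rfl⟩)
    rw [Finset.mem_singleton] at hu
    exact absurd (hu ▸ hu') hx
  | @eve x y ho hE _ ih =>
    by_cases hxt : x.1 = t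
    · rw [hxt]; exact G.le_refl t
    · exact .eve ho hE.1 (ih (by rw [hE.2]; simp [hx, Ne.symm hxt]))
  | @adam x ho _ ih =>
    by_cases hxt : x.1 = t
    · rw [hxt]; exact G.le_refl t
    · exact .adam ho fun w hw => ih (w, insert x.1 x.2) ⟨hw, rfl⟩ (by simp [hx, Ne.symm hxt])

/-- The derivation is followed to the first of the two targets; that position still wins and the
other target is unvisited, so `Game.Wins.le` applies. At a vertex of Adam any successor will do, and
there is one. -/
theorem Game.Wins.total {t t' : V} (ht : t ∈ G.singles) (ht' : t' ∈ G.singles) {x : V × Set V}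
    (h : G.Wins x) (hx : t ∉ x.2) (hx' : t' ∉ x.2) : G.le t t' ∨ G.le t' t := by
  induction h with
  | base h =>
    obtain ⟨u, hu, hu'⟩ := h {t} (.inr ⟨t, ht, rfl⟩)
    rw [Finset.mem_singleton] at hu
    exact absurd (hu ▸ hu') hx
  | @eve x y ho hE hy ih =>
    by_cases hxt : x.1 = t
    · exact .inl (hxt ▸ Game.Wins.le ht' (.eve ho hE hy) hx')
    by_cases hxt' : x.1 = t'
    · exact .inr (hxt' ▸ Game.Wins.le ht (.eve ho hE hy) hx)
    · exact ih (by rw [hE.2]; simp [hx, Ne.symm hxt]) (by rw [hE.2]; simp [hx', Ne.symm hxt'])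
  | @adam x ho hy ih =>
    by_cases hxt : x.1 = t
    · exact .inl (hxt ▸ Game.Wins.le ht' (.adam ho hy) hx')
    by_cases hxt' : x.1 = t'
    · exact .inr (hxt' ▸ Game.Wins.le ht (.adam ho hy) hx)
    · obtain ⟨w, hw⟩ := G.arena.exists_succ x.1
      exact ih (w, insert x.1 x.2) ⟨hw, rfl⟩ (by simp [hx, Ne.symm hxt])
        (by simp [hx', Ne.symm hxt'])

/-- If `v` is below `t`, its down-set is contained in that of `t`. If moreover `height t ≤ height
v`, the two coincide, and `t` is below `v`. -/
theorem Game.height_le_iff (htot : ∀ t ∈ G.singles, ∀ t' ∈ G.singles, G.le t t' ∨ G.le t' t)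
    {t v : V} (ht : t ∈ G.singles) (hv : v ∈ G.singles) : G.height t ≤ G.height v ↔ G.le t v := by
  classical
  refine ⟨fun h => ?_, G.height_mono⟩
  rcases htot t ht v hv with h' | h'
  · exact h'
  have heq := Finset.eq_of_subset_of_card_le
    (Finset.monotone_filter_right (p := (G.le · v)) (q := (G.le · t)) G.singles
      fun u _ hu => G.le_trans hu h') h
  have hmem : t ∈ G.singles.filter (G.le · v) := by
    rw [heq]; simp [ht, G.le_refl]
  exact (Finset.mem_filter.1 hmem).2

open scoped Classical in
/-- Winning the product with the monitors is necessary. -/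
theorem Game.Wins.monitorWins {mem : ℕ → V → Prop} {k : ℕ}
    (hmem : ∀ D : Set V, (∀ X ∈ G.sets, ∃ u ∈ X, u ∈ D) ↔ ∀ i < k, ∃ u ∈ D, mem i u)
    (htot : ∀ t ∈ G.singles, ∀ t' ∈ G.singles, G.le t t' ∨ G.le t' t)
    {x : V × Set V} (h : G.Wins x) :
    ∀ q : ℕ → ℕ, (∀ i, q (i + 1) ≤ 1 ∧ ((∃ u ∈ x.2, mem i u) → q (i + 1) = 1)) →
      (G.singles.filter (G.height · ≤ q 0)).card = q 0 →
      (∀ t ∈ G.singles, t ∈ x.2 → G.height t ≤ q 0) →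
      G.MonitorWins (G.lo mem) G.hi G.levels k (x.1, q) := by
  have hstep : ∀ (x : V × Set V) (q : ℕ → ℕ),
      (∀ i, q (i + 1) ≤ 1 ∧ ((∃ u ∈ x.2, mem i u) → q (i + 1) = 1)) → ∀ i,
        jump (G.lo mem (i + 1) x.1) (G.hi (i + 1) x.1) (q (i + 1)) ≤ 1 ∧
          ((∃ u ∈ insert x.1 x.2, mem i u) →
            jump (G.lo mem (i + 1) x.1) (G.hi (i + 1) x.1) (q (i + 1)) = 1) := by
    intro x q hq i
    obtain ⟨h1, h2⟩ := hq i
    rw [Game.hi_succ]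
    refine ⟨by unfold jump; split <;> omega, ?_⟩
    rintro ⟨u, rfl | hu, hu'⟩
    · rw [G.lo_succ_of_mem hu', jump]
      split <;> omega
    · rw [h2 ⟨u, hu, hu'⟩]
      unfold jump
      split <;> rfl
  -- The counter invariant: exactly `q 0` singletons have height at most `q 0`, so the level lies at
  -- the boundary of a class, and all visited singletons are within it.
  have hchain : ∀ (x : V × Set V) (q : ℕ → ℕ), G.Wins x →
      (G.singles.filter (G.height · ≤ q 0)).card = q 0 →
      (∀ t ∈ G.singles, t ∈ x.2 → G.height t ≤ q 0) →
      ∀ c, c = jump (G.lo mem 0 x.1) (G.hi 0 x.1) (q 0) →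
        (G.singles.filter (G.height · ≤ c)).card = c ∧
          ∀ t ∈ G.singles, t ∈ insert x.1 x.2 → G.height t ≤ c := by
    rintro ⟨v, D⟩ q hw h1 h2 c hc
    simp only at hc h2 ⊢
    have hle : q 0 ≤ G.singles.card := h1 ▸ Finset.card_filter_le _ _
    by_cases hv : v ∈ G.singles
    · have hlt : G.lower v < G.height v := by
        refine Finset.card_lt_card ⟨fun t ht => ?_, fun hs => ?_⟩
        · simp only [Finset.mem_filter] at ht ⊢
          exact ⟨ht.1, (G.height_le_iff htot ht.1 hv).1 ht.2.le⟩
        · have := hs (Finset.mem_filter.2 ⟨hv, G.le_refl v⟩)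
          simp at this
      by_cases hq : G.lower v = q 0
      · have : c = G.height v := by
          rw [hc, G.lo_zero_of_mem mem hv hlt, hq, jump_self, G.hi_zero_of_mem hv]
        subst this
        refine ⟨congrArg Finset.card (Finset.filter_congr fun t ht => G.height_le_iff htot ht hv),
          fun t ht ht' => ?_⟩
        rcases ht' with rfl | ht'
        · exact le_rfl
        · exact (h2 t ht ht').trans (by omega)
      · have : c = q 0 := by
          rw [hc, G.lo_zero_of_mem mem hv hlt, jump_of_ne _ hq]
        subst this
        refine ⟨h1, fun t ht ht' => ?_⟩
        rcases ht' with rfl | ht'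
        -- If `t` were above the level without being next, some singleton `u` above the level would
        -- have height less than `t`. It is unvisited, so Eve can force it from `t`, contradicting
        -- the monotonicity of heights.
        · by_contra hn
          have hsub : G.singles.filter (G.height · ≤ q 0) ⊆
              G.singles.filter fun t' => G.height t' < G.height t :=
            Finset.monotone_filter_right _ fun u _ hu => by omega
          have hss : G.singles.filter (G.height · ≤ q 0) ⊂
              G.singles.filter fun t' => G.height t' < G.height t := by
            refine hsub.ssubset_of_ne fun he => hq ?_
            rw [← h1, he]; rfl
          obtain ⟨u, hu, hu'⟩ := Finset.exists_of_ssubset hss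
          simp only [Finset.mem_filter, not_and, not_le] at hu hu'
          have huD : u ∉ D := fun h => by
            have := h2 u hu.1 h
            have := hu' hu.1
            omega
          have := G.height_mono (hw.le hu.1 huD)
          simp only at this
          omega
        · exact h2 t ht ht'
    · have : c = q 0 := by
        rw [hc, G.lo_zero_of_not mem fun h => hv h.1, jump_of_ne _ (by omega)]
      subst this
      refine ⟨h1, fun t ht ht' => h2 t ht ?_⟩
      rcases ht' with rfl | ht'
      · exact absurd ht hv
      · exact ht'
  induction h with
  | @base x hx =>
    intro q h1 h2 h3
    refine .base fun i _ => ?_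
    cases i with
    | zero =>
      simp only [Game.levels, Nat.add_right_cancel_iff]
      rw [← h2, Finset.filter_true_of_mem fun t ht => h3 t ht ?_]
      obtain ⟨u, hu, hu'⟩ := hx {t} (.inr ⟨t, ht, rfl⟩)
      rw [Finset.mem_singleton] at hu
      exact hu ▸ hu'
    | succ i =>
      simp only [Game.levels, Nat.reduceEqDiff]
      exact (h1 i).2 ((hmem x.2).1 (fun X hX => hx X (.inl hX)) i (by omega))
  | @eve x y ho hE hy ih =>
    intro q h1 h2 h3
    refine .eve ho (y := (y.1, fun i => jump (G.lo mem i x.1) (G.hi i x.1) (q i))) ⟨hE.1, rfl⟩ ?_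
    obtain ⟨h4, h5⟩ := hchain x q (.eve ho hE hy) h2 h3 _ rfl
    refine ih _ ?_ h4 (by rwa [hE.2])
    rw [hE.2]
    exact hstep x q h1
  | @adam x ho hy ih =>
    intro q h1 h2 h3
    refine .adam ho ?_
    rintro ⟨w, _⟩ ⟨hE, rfl⟩
    obtain ⟨h4, h5⟩ := hchain x q (.adam ho hy) h2 h3 _ rfl
    exact ih (w, insert x.1 x.2) ⟨hE, rfl⟩ _ (hstep x q h1) h4 h5

/-- Totality is drawn from the start position, where nothing has been visited. Level 0 satisfies the
counter invariant because heights of singletons are positive. -/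
theorem Game.eveWins_iff_monitorWins {mem : ℕ → V → Prop} {k : ℕ}
    (hmem : ∀ D : Set V, (∀ X ∈ G.sets, ∃ u ∈ X, u ∈ D) ↔ ∀ i < k, ∃ u ∈ D, mem i u) :
    G.EveWins ↔ G.MonitorWins (G.lo mem) G.hi G.levels k (G.start, fun _ => 0) := by
  classical
  rw [Game.eveWins_iff]
  refine ⟨fun h => h.monitorWins hmem (fun t ht t' ht' => h.total ht ht' (by simp) (by simp)) _
    (by simp) ?_ (by simp), fun h => h.wins hmem _ (by simp) (by simp)⟩
  rw [Finset.card_eq_zero, Finset.filter_eq_empty_iff]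
  intro t ht
  have := G.height_pos ht
  omega

end Monitor

/-! ### Numbering the vertices of the product -/

/-- Attractors are preserved by bisimulations. -/
theorem Attr.bisim {X Y : Type*} {E : X → X → Prop} {eve T : X → Prop} {E' : Y → Y → Prop}
    {eve' T' : Y → Prop} {R : X → Y → Prop} (hT : ∀ x y, R x y → T x → T' y)
    (heve : ∀ x y, R x y → (eve x ↔ eve' y))
    (hE : ∀ x y, R x y → ∀ x', E x x' → ∃ y', E' y y' ∧ R x' y')
    (hE' : ∀ x y, R x y → ∀ y', E' y y' → ∃ x', E x x' ∧ R x' y')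
    {x : X} (h : Attr E eve T x) : ∀ y, R x y → Attr E' eve' T' y := by
  induction h with
  | base h => exact fun y hR => .base (hT _ _ hR h)
  | eve hx hxy _ ih =>
    intro y hR
    obtain ⟨y', hy', hR'⟩ := hE _ _ hR _ hxy
    exact .eve ((heve _ _ hR).1 hx) hy' (ih _ hR')
  | adam hx _ ih =>
    refine fun y hR => .adam (fun h => hx ((heve _ _ hR).2 h)) fun y' hy' => ?_
    obtain ⟨x', hx', hR'⟩ := hE' _ _ hR _ hy'
    exact ih _ hx' _ hR'

theorem Attr.bisim_iff {X Y : Type*} {E : X → X → Prop} {eve T : X → Prop} {E' : Y → Y → Prop}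
    {eve' T' : Y → Prop} {R : X → Y → Prop} (hT : ∀ x y, R x y → (T x ↔ T' y))
    (heve : ∀ x y, R x y → (eve x ↔ eve' y))
    (hE : ∀ x y, R x y → ∀ x', E x x' → ∃ y', E' y y' ∧ R x' y')
    (hE' : ∀ x y, R x y → ∀ y', E' y y' → ∃ x', E x x' ∧ R x' y')
    {x : X} {y : Y} (hR : R x y) : Attr E eve T x ↔ Attr E' eve' T' y :=
  ⟨fun h => h.bisim (R := R) (fun x y hR => (hT x y hR).1) heve hE hE' y hR,
    fun h => h.bisim (R := fun y x => R x y) (fun y x hR => (hT x y hR).2)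
      (fun y x hR => (heve x y hR).symm) (fun y x hR => hE' x y hR) (fun y x hR => hE x y hR) x hR⟩

section Code

variable {V : Type*} [Fintype V] (num : V ≃ Fin (Fintype.card V)) (L : ℕ → ℕ)

/-- The number of copies of the arena in the product with `j` monitors. -/
def copies : ℕ → ℕ
  | 0 => 1
  | j + 1 => copies j * L j

/-- The number of a vertex of the product with `j` monitors. -/
def code : ℕ → V → (ℕ → ℕ) → ℕ
  | 0, v, _ => num v
  | j + 1, v, q => code j v q + q j * (Fintype.card V * copies L j)

variable {num L}

theorem copies_pos (hL : ∀ i, 0 < L i) (j : ℕ) : 0 < copies L j := by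
  induction j with
  | zero => exact one_pos
  | succ j ih => exact Nat.mul_pos ih (hL j)

theorem code_lt {j : ℕ} {v : V} {q : ℕ → ℕ} (hq : ∀ i < j, q i < L i) :
    code num L j v q < Fintype.card V * copies L j := by
  induction j with
  | zero => simp [code, copies]
  | succ j ih =>
    have h1 := ih fun i hi => hq i (by omega)
    have h2 := Nat.mul_le_mul_right (Fintype.card V * copies L j) (hq j (by omega))
    simp only [code, copies, Nat.succ_eq_add_one, add_mul, one_mul] at h2 ⊢
    rw [show Fintype.card V * (copies L j * L j) = L j * (Fintype.card V * copies L j) by ring]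
    omega

theorem code_congr {j : ℕ} {v : V} {q q' : ℕ → ℕ} (h : ∀ i < j, q i = q' i) :
    code num L j v q = code num L j v q' := by
  induction j with
  | zero => rfl
  | succ j ih => rw [code, code, ih fun i hi => h i (by omega), h j (by omega)]

/-- The last monitor is the most significant digit: division by the size of the preceding product
reads it off. -/
theorem code_inj {j : ℕ} {v v' : V} {q q' : ℕ → ℕ} (hq : ∀ i < j, q i < L i)
    (hq' : ∀ i < j, q' i < L i) (h : code num L j v q = code num L j v' q') :
    v = v' ∧ ∀ i < j, q i = q' i := by
  induction j with
  | zero => exact ⟨num.injective (Fin.ext h), by simp⟩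
  | succ j ih =>
    have h1 := code_lt (num := num) (v := v) fun i hi => hq i (Nat.lt_succ_of_lt hi)
    have h2 := code_lt (num := num) (v := v') fun i hi => hq' i (Nat.lt_succ_of_lt hi)
    simp only [code] at h
    have hpos : 0 < Fintype.card V * copies L j := by omega
    have hdiv := congrArg (· / (Fintype.card V * copies L j)) h
    simp only [Nat.add_mul_div_right _ _ hpos, Nat.div_eq_of_lt h1, Nat.div_eq_of_lt h2,
      zero_add] at hdiv
    rw [hdiv, Nat.add_right_cancel_iff] at h
    obtain ⟨h3, h4⟩ := ih (fun i hi => hq i (Nat.lt_succ_of_lt hi))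
      (fun i hi => hq' i (Nat.lt_succ_of_lt hi)) h
    refine ⟨h3, fun i hi => ?_⟩
    rcases Nat.lt_succ_iff_lt_or_eq.1 hi with hi | rfl
    · exact h4 i hi
    · exact hdiv

theorem exists_code {j : ℕ} {x : ℕ} (hx : x < Fintype.card V * copies L j) :
    ∃ v q, (∀ i < j, q i < L i) ∧ code num L j v q = x := by
  induction j generalizing x with
  | zero =>
    simp only [copies, mul_one] at hx
    exact ⟨num.symm ⟨x, hx⟩, fun _ => 0, by simp, by simp [code]⟩
  | succ j ih =>
    have hpos : 0 < Fintype.card V * copies L j := by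
      refine Nat.pos_of_ne_zero fun h => ?_
      rw [copies, ← mul_assoc, h, zero_mul] at hx
      omega
    obtain ⟨v, q, hq, hc⟩ := ih (Nat.mod_lt x hpos)
    refine ⟨v, Function.update q j (x / (Fintype.card V * copies L j)), fun i hi => ?_, ?_⟩
    · rcases Nat.lt_succ_iff_lt_or_eq.1 hi with hi | rfl
      · rw [Function.update_of_ne hi.ne]; exact hq i hi
      · rw [Function.update_self, Nat.div_lt_iff_lt_mul hpos, mul_comm, mul_assoc]; exact hx
    · rw [code, Function.update_self, code_congr (q' := q), hc]
      · exact Nat.mod_add_div' _ _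
      · intro i hi; rw [Function.update_of_ne hi.ne]

theorem code_update (j : ℕ) (v : V) (q : ℕ → ℕ) (c : ℕ) :
    code num L (j + 1) v (Function.update q j c) =
      code num L j v q + c * (Fintype.card V * copies L j) := by
  rw [code, Function.update_self,
    code_congr fun i hi => by rw [Function.update_of_ne (Nat.ne_of_lt hi)]]

/-- The vertices with all monitors at their last levels have the largest numbers. -/
theorem le_code_iff (hL : ∀ i, 0 < L i) {j : ℕ} {v : V} {q : ℕ → ℕ} (hq : ∀ i < j, q i < L i) :
    Fintype.card V * copies L j - Fintype.card V ≤ code num L j v q ↔ ∀ i < j, q i + 1 = L i := by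
  induction j with
  | zero => simp [copies]
  | succ j ih =>
    have ih := ih fun i hi => hq i (by omega)
    have h1 := code_lt (num := num) (v := v) fun i hi => hq i (Nat.lt_succ_of_lt hi)
    have h2 : Fintype.card V ≤ Fintype.card V * copies L j :=
      Nat.le_mul_of_pos_right _ (copies_pos hL j)
    have h3 : Fintype.card V * copies L (j + 1) = L j * (Fintype.card V * copies L j) := by
      rw [copies]; ring
    rw [h3, code]
    set K := Fintype.card V * copies L j
    by_cases hj : q j + 1 = L j
    · have h4 : L j * K = q j * K + K := by rw [← hj, add_mul, one_mul]
      rw [show L j * K - Fintype.card V ≤ code num L j v q + q j * K ↔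
        K - Fintype.card V ≤ code num L j v q by omega, ih]
      refine ⟨fun h i hi => ?_, fun h i hi => h i (by omega)⟩
      rcases Nat.lt_succ_iff_lt_or_eq.1 hi with hi | rfl
      · exact h i hi
      · exact hj
    -- If the top digit is not the last one, the code misses the end by more than a block of `K ≥
    -- |V|` numbers.
    · have h4 : (q j + 2) * K ≤ L j * K :=
        Nat.mul_le_mul_right _ (by have := hq j (by omega); omega)
      rw [add_mul] at h4
      exact ⟨fun h => by omega, fun h => absurd (h j (by omega)) hj⟩

end Code

section ProductGraph

variable {V : Type*} [Fintype V] (num : V ≃ Fin (Fintype.card V)) (L : ℕ → ℕ) (A : Arena V)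
  (lo hi : ℕ → V → ℕ)

/-- The arrays `0`, `1`, `2` and `14` hold the product of the arena with `j` monitors. -/
structure IsProduct (j : ℕ) (μ : Mem) : Prop where
  vertices : μ.reg 10 = Fintype.card V * copies L j
  edges : μ.reg 11 = A.edges.card * copies L j
  owner : ∀ v q, (∀ i < j, q i < L i) → μ.arr 0 (code num L j v q) = (A.owner v).code
  label : ∀ v q, (∀ i < j, q i < L i) → μ.arr 14 (code num L j v q) = num v
  edge : ∀ e < A.edges.card * copies L j, ∃ u w q, (u, w) ∈ A.edges ∧ (∀ i < j, q i < L i) ∧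
    μ.arr 1 e = code num L j u q ∧
      μ.arr 2 e = code num L j w fun i => jump (lo i u) (hi i u) (q i)
  exists_edge : ∀ u w q, (u, w) ∈ A.edges → (∀ i < j, q i < L i) →
    ∃ e < A.edges.card * copies L j, μ.arr 1 e = code num L j u q ∧
      μ.arr 2 e = code num L j w fun i => jump (lo i u) (hi i u) (q i)

variable {num L A lo hi}

theorem IsProduct.of_eq {j : ℕ} {μ μ' : Mem} (h : IsProduct num L A lo hi j μ)
    (h10 : μ'.reg 10 = μ.reg 10) (h11 : μ'.reg 11 = μ.reg 11) (h0 : μ'.arr 0 = μ.arr 0)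
    (h1 : μ'.arr 1 = μ.arr 1) (h2 : μ'.arr 2 = μ.arr 2) (h14 : μ'.arr 14 = μ.arr 14) :
    IsProduct num L A lo hi j μ' := by
  constructor
  · rw [h10]; exact h.vertices
  · rw [h11]; exact h.edges
  · rw [h0]; exact h.owner
  · rw [h14]; exact h.label
  · rw [h1, h2]; exact h.edge
  · rw [h1, h2]; exact h.exists_edge

/-- Every vertex is the source of an edge. This allows all time bounds to be stated by edges. -/
theorem Arena.card_le_card_edges (A : Arena V) : Fintype.card V ≤ A.edges.card := by
  classical
  refine (Finset.card_le_card (s := Finset.univ) fun v _ => ?_).trans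
    (Finset.card_image_le (f := Prod.fst))
  obtain ⟨w, hw⟩ := A.exists_succ v
  exact Finset.mem_image.2 ⟨_, hw, rfl⟩

theorem jump_lt {l h c n : ℕ} (hh : h < n) (hc : c < n) : jump l h c < n := by
  unfold jump; split <;> assumption

/-- Numbers and pairs of a vertex with levels are bisimilar via `code`. Only the levels of the first
`j` monitors are constrained, since the code ignores the others. -/
theorem IsProduct.attrProg_runs (hhi : ∀ i v, hi i v < L i) {j : ℕ} {μ : Mem}
    (h : IsProduct num L A lo hi j μ) {a b : ℕ} (ha : μ.reg 12 = a) (hb : μ.reg 13 = b)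
    (hbN : b ≤ Fintype.card V * copies L j) :
    Runs attrProg μ (A.edges.card * copies L j * 180 + 50) fun μ' =>
      ∀ v q, (∀ i < j, q i < L i) → (μ'.arr 10 (code num L j v q) = 0 ↔
        Attr (fun x y : V × (ℕ → ℕ) => (x.1, y.1) ∈ A.edges ∧
            y.2 = fun i => jump (lo i x.1) (hi i x.1) (x.2 i))
          (fun x => A.owner x.1 = .eve)
          (fun x => a ≤ code num L j x.1 x.2 ∧ code num L j x.1 x.2 < b) (v, q)) := by
  have hc : Fintype.card V * copies L j ≤ A.edges.card * copies L j :=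
    Nat.mul_le_mul_right _ A.card_le_card_edges
  refine (GenReach.attrProg_runs h.vertices h.edges ha hb hbN ?_ ?_ ?_ ?_).mono (by omega)
    fun μ' hμ' v q hq => ?_
  · intro e he
    obtain ⟨u, w, q, -, hq, h1, -⟩ := h.edge e he
    rw [h1]; exact code_lt hq
  · intro e he
    obtain ⟨u, w, q, -, hq, -, h2⟩ := h.edge e he
    rw [h2]; exact code_lt fun i hi' => jump_lt (hhi i u) (hq i hi')
  · intro x hx
    obtain ⟨v, q, hq, rfl⟩ := exists_code (num := num) hx
    rw [h.owner v q hq]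
    cases A.owner v <;> simp [Player.code]
  · intro x hx
    obtain ⟨v, q, hq, rfl⟩ := exists_code (num := num) hx
    obtain ⟨w, hw⟩ := A.exists_succ v
    obtain ⟨e, he, h1, -⟩ := h.exists_edge v w q hw hq
    exact ⟨e, he, h1⟩
  · rw [hμ' _ (code_lt hq)]
    refine (Attr.bisim_iff (R := fun (x : V × (ℕ → ℕ)) y => (∀ i < j, x.2 i < L i) ∧
      y = code num L j x.1 x.2) (x := (v, q)) ?_ ?_ ?_ ?_ ⟨hq, rfl⟩).symm
    · rintro x _ ⟨hx, rfl⟩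
      rfl
    · rintro x _ ⟨hx, rfl⟩
      rw [h.owner _ _ hx]
      cases A.owner x.1 <;> simp [Player.code]
    · rintro x _ ⟨hx, rfl⟩ ⟨w, q'⟩ ⟨hE, rfl⟩
      obtain ⟨e, he, h1, h2⟩ := h.exists_edge _ _ _ hE hx
      exact ⟨_, ⟨e, he, h1, rfl⟩, fun i hi' => jump_lt (hhi i x.1) (hx i hi'), h2⟩
    · rintro x _ ⟨hx, rfl⟩ _ ⟨e, he, h1, rfl⟩
      obtain ⟨u, w, q', hE, hq', h1', h2⟩ := h.edge e he
      obtain ⟨rfl, hqq⟩ := code_inj hq' hx (h1'.symm.trans h1)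
      refine ⟨(w, fun i => jump (lo i x.1) (hi i x.1) (x.2 i)), ⟨hE, rfl⟩,
        fun i hi' => jump_lt (hhi i x.1) (hx i hi'), h2.trans (code_congr fun i hi' => ?_)⟩
      rw [hqq i hi']

/-- The new monitor contributes the top digit `c`: edge `r` of the old product becomes edge `r + M *
c`, where `M` is the old number of edges. The labels let the monitor read the arena vertex behind a
product vertex. -/
theorem IsProduct.prodProg_runs (hhi : ∀ i v, hi i v < L i) {j : ℕ} {μ : Mem} (v₀ : V)
    (h : IsProduct num L A lo hi j μ) (hLj : μ.reg 14 = L j) (h15 : ∀ v, μ.arr 15 (num v) = lo j v)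
    (h16 : ∀ v, μ.arr 16 (num v) = hi j v) :
    Runs prodProg μ (A.edges.card * copies L (j + 1) * 300) (IsProduct num L A lo hi (j + 1)) := by
  have hL : ∀ i, 0 < L i := fun i => (Nat.zero_le _).trans_lt (hhi i v₀)
  have hV : 0 < Fintype.card V := Fintype.card_pos_iff.2 ⟨v₀⟩
  have hc : Fintype.card V * copies L j ≤ A.edges.card * copies L j :=
    Nat.mul_le_mul_right _ A.card_le_card_edges
  have hN : 0 < Fintype.card V * copies L j := Nat.mul_pos hV (copies_pos hL j)
  have hM : 0 < A.edges.card * copies L j := hN.trans_le hc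
  refine (GenReach.prodProg_runs h.vertices h.edges hLj hN hM (hL j) ?_).mono ?_
    fun μ' ⟨h10, h11, he, hv⟩ => ?_
  · intro e he
    obtain ⟨u, w, q, -, hq, h1, -⟩ := h.edge e he
    rw [h1, h.label _ _ hq, h16]; exact hhi j u
  · have := Nat.mul_le_mul_right (L j) hc
    rw [copies, ← mul_assoc, add_mul]
    omega
  have hvq : ∀ v q, (∀ i < j + 1, q i < L i) →
      code num L (j + 1) v q < Fintype.card V * copies L j * L j ∧
      code num L (j + 1) v q % (Fintype.card V * copies L j) = code num L j v q ∧
      ∀ i < j, q i < L i := by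
    intro v q hq
    have hq' : ∀ i < j, q i < L i := fun i hi' => hq i (Nat.lt_succ_of_lt hi')
    refine ⟨?_, ?_, hq'⟩
    · rw [mul_assoc]; exact code_lt hq
    · rw [code, Nat.add_mul_mod_self_right, Nat.mod_eq_of_lt (code_lt hq')]
  refine ⟨by rw [h10, copies, mul_assoc], by rw [h11, copies, mul_assoc], ?_, ?_, ?_, ?_⟩
  · intro v q hq
    obtain ⟨h1, h2, h3⟩ := hvq v q hq
    rw [(hv _ h1).1, h2, h.owner v q h3]
  · intro v q hq
    obtain ⟨h1, h2, h3⟩ := hvq v q hq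
    rw [(hv _ h1).2, h2, h.label v q h3]
  · intro e he'
    rw [copies, ← mul_assoc] at he'
    obtain ⟨h1, h2⟩ := he e he'
    obtain ⟨u, w, q, hE, hq, h3, h4⟩ := h.edge _ (Nat.mod_lt e hM)
    have hcl : e / (A.edges.card * copies L j) < L j := by
      rw [Nat.div_lt_iff_lt_mul hM, mul_comm]; exact he'
    refine ⟨u, w, Function.update q j (e / (A.edges.card * copies L j)), hE, fun i hi' => ?_, ?_, ?_⟩
    · rcases Nat.lt_succ_iff_lt_or_eq.1 hi' with hi' | rfl
      · rw [Function.update_of_ne hi'.ne]; exact hq i hi'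
      · rw [Function.update_self]; exact hcl
    · rw [h1, h3, code_update]
    · rw [h2, h3, h4, h.label _ _ hq, h15, h16, code, Function.update_self]
      congr 1
      exact code_congr fun i hi' => by rw [Function.update_of_ne hi'.ne]
  · intro u w q hE hq
    obtain ⟨-, -, hq'⟩ := hvq u q hq
    obtain ⟨r, hr, h1, h2⟩ := h.exists_edge u w q hE hq'
    have hlt : r + A.edges.card * copies L j * q j < A.edges.card * copies L j * L j := by
      have := Nat.mul_le_mul_left (A.edges.card * copies L j) (hq j (by omega))
      rw [Nat.succ_eq_add_one, mul_add, mul_one] at this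
      omega
    obtain ⟨h3, h4⟩ := he _ hlt
    rw [Nat.add_mul_mod_self_left, Nat.mod_eq_of_lt hr, Nat.add_mul_div_left _ _ hM,
      Nat.div_eq_of_lt hr, zero_add] at h3 h4
    refine ⟨_, by rw [copies, ← mul_assoc]; exact hlt, ?_, ?_⟩
    · rw [h3, h1, code]
    · rw [h4, h1, h2, h.label _ _ hq', h15, h16, code]

end ProductGraph

/-! ### The program -/

/-- Numbers the labels and resets the jumps of the first monitor. -/
def initProg : Prog :=
  .seq (.loop (.sub (.reg 0) (.reg 30))
    (.seq (.store 14 (.reg 30) (.reg 30))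
      (.seq (.store 15 (.reg 30) (.add (.reg 2) (.const 1))) (.incr 30))))
    (.seq (.assign 10 (.reg 0)) (.assign 11 (.reg 1)))

/-- Counts the indices, in register `31`, of singleton targets for which `x` is not `0`. -/
def countProg (x : Expr) : Prog :=
  .seq (.seq (.assign 31 (.const 0)) (.assign 32 (.const 0)))
    (.loop (.sub (.reg 2) (.reg 31)) (.seq (.cond x (.incr 32) .skip) (.incr 31)))

/-- Computes the heights of the singleton targets in the array `19`. -/
def heightProg : Prog :=
  .seq (.assign 30 (.const 0))
    (.loop (.sub (.reg 2) (.reg 30))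
      (.seq (.seq (.assign 12 (.load 3 (.reg 30)))
        (.assign 13 (.add (.load 3 (.reg 30)) (.const 1)))) <|
      .seq attrProg <|
      .seq (countProg (.sub (.const 1) (.load 10 (.load 3 (.reg 31))))) <|
      .seq (.store 19 (.reg 30) (.reg 32)) (.incr 30)))

/-- Computes the jumps of the monitor for the singleton targets. -/
def chainProg : Prog :=
  .seq (.assign 30 (.const 0))
    (.loop (.sub (.reg 2) (.reg 30))
      (.seq (countProg (.sub (.load 19 (.reg 30)) (.load 19 (.reg 31)))) <|
      .seq (.cond (.sub (.load 19 (.reg 30)) (.reg 32)) .skip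
        (.assign 32 (.add (.reg 2) (.const 1)))) <|
      .seq (.store 15 (.load 3 (.reg 30)) (.reg 32)) <|
      .seq (.store 16 (.load 3 (.reg 30)) (.load 19 (.reg 30))) (.incr 30)))

/-- Resets the jumps of the monitor for a target set. -/
def clearProg : Prog :=
  .seq (.assign 31 (.const 0))
    (.loop (.sub (.reg 0) (.reg 31))
      (.seq (.store 15 (.reg 31) (.const 2))
        (.seq (.store 16 (.reg 31) (.const 1)) (.incr 31))))

/-- Reads the elements of a target set. -/
def markProg : Prog :=
  .seq (.assign 34 (.load 4 (.reg 30)))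
    (.loop (.reg 34)
      (.seq (.store 15 (.load 5 (.reg 33)) (.const 0))
        (.seq (.incr 33) (.assign 34 (.sub (.reg 34) (.const 1))))))

/-- Builds the products with the monitors for the target sets. -/
def setsProg : Prog :=
  .seq (.seq (.assign 30 (.const 0)) (.assign 14 (.const 2)))
    (.loop (.sub (.reg 3) (.reg 30))
      (.seq clearProg <| .seq markProg <| .seq prodProg (.incr 30)))

/-- Decides whether the start vertex of the product belongs to the attractor. -/
def finalProg : Prog :=
  .seq (.seq (.assign 12 (.sub (.reg 10) (.reg 0))) (.assign 13 (.reg 10))) <|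
  .seq attrProg (.assign 0 (.sub (.const 1) (.load 10 (.reg 4))))

/-- Decides generalised reachability games. -/
def solveProg : Prog :=
  .seq initProg <| .seq heightProg <| .seq chainProg <|
  .seq (.assign 14 (.add (.reg 2) (.const 1))) <| .seq prodProg <| .seq setsProg finalProg

/-! ### Correctness and cost of the parts of the program. -/

theorem countProg_runs {α : Type*} {x : Expr} {μ : Mem} (l : List α) (p : α → Prop)
    [DecidablePred p] (h2 : μ.reg 2 = l.length)
    (hx : ∀ μ', Same (countProg x) μ μ' → ∀ i (hi : i < l.length), μ'.reg 31 = i →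
      (x.eval μ' ≠ 0 ↔ p l[i])) :
    Runs (countProg x) μ (l.length * (x.cost + 13) + 8) fun μ' => μ'.reg 32 = l.countP p := by
  refine (((Prog.runs rfl μ).mono (B' := 4) (by decide) fun _ h => h).seq fun μ₁ s₁ h₁ => ?_).mono
    (B := 4 + (l.length * (x.cost + 13) + 4)) (by omega) fun _ h => h
  refine (Runs.loop l.length (x.cost + 9) (fun i μ' => μ'.reg 31 = i ∧
    μ'.reg 32 = (l.take i).countP p) (by simp [h₁, Prog.run, Expr.eval]) ?_ ?_).mono
      (by simp [Expr.cost]) fun μ' h => by simpa using h.2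
  · rintro i hi μ' hs ⟨h31, h32⟩
    have hs' : Same (countProg x) μ μ' :=
      (s₁.mono (by simp [countProg, Prog.regs]) (by simp [Prog.arrs])).trans
        (hs.mono (by simp [countProg, Prog.regs]) (by simp [countProg, Prog.arrs]))
    have hxi := hx μ' hs' i hi h31
    have r2 : μ'.reg 2 = l.length := (hs'.reg 2 (by simp [countProg, Prog.regs, Prog.incr])).trans h2
    refine ⟨by simp [Expr.eval, r2, h31]; omega, Runs.of_run rfl ?_ ?_⟩
    · simp [Prog.time, Prog.incr, Expr.cost]
    rw [List.take_succ_eq_append_getElem hi, List.countP_append, ← h32, List.countP_singleton]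
    by_cases hp : p l[i]
    · have := hxi.2 hp
      simp [Prog.run, Prog.incr, Expr.eval, this, hp, h31]
    · have := not_not.1 (mt hxi.1 hp)
      simp [Prog.run, Prog.incr, Expr.eval, this, hp, h31]
  · rintro μ' hs ⟨h31, -⟩
    have r2 : μ'.reg 2 = l.length := by
      rw [hs.reg 2 (by simp [Prog.regs, Prog.incr]), s₁.reg 2 (by decide), h2]
    simp [Expr.eval, r2, h31]

theorem Game.hi_lt_levels {V : Type*} {G : Game V} (i : ℕ) (v : V) : G.hi i v < G.levels i := by
  cases i with
  | zero =>
    by_cases hv : v ∈ G.singles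
    · rw [G.hi_zero_of_mem hv]
      exact Nat.lt_succ_of_le (G.height_le v)
    · exact (if_neg hv).trans_lt (Nat.succ_pos _)
  | succ i => exact Nat.one_lt_two

theorem Game.copies_levels {V : Type*} (G : Game V) (j : ℕ) :
    copies G.levels (j + 1) = (G.singles.card + 1) * 2 ^ j := by
  induction j with
  | zero => simp [copies, Game.levels]
  | succ j ih => rw [copies, ih, pow_succ, mul_assoc]; rfl

section Presentation

variable {V : Type*} [Fintype V] {G : Game V} (P : Presentation G)

/-- The set with index `i` contains `v`. -/
def Presentation.mem (i : ℕ) (v : V) : Prop := v ∈ P.sets.getD i []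

/-- The memory still holds the input, apart from the arena. -/
structure Presentation.Kept (μ : Mem) : Prop where
  reg : ∀ r < 5, μ.reg r = P.input.reg r
  arr : ∀ a < 6, 3 ≤ a → μ.arr a = P.input.arr a

variable {P}

theorem Presentation.Kept.same {p : Prog} {μ μ' : Mem} (h : P.Kept μ) (hs : Same p μ μ')
    (hr : ∀ r < 5, r ∉ p.regs) (ha : ∀ a < 6, 3 ≤ a → a ∉ p.arrs) : P.Kept μ' :=
  ⟨fun r h' => (hs.reg r (hr r h')).trans (h.reg r h'),
    fun a h' h'' => (hs.arr a (ha a h' h'')).trans (h.arr a h' h'')⟩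

variable (P)

theorem Presentation.length_edges : P.edges.length = G.arena.edges.card := by
  rw [← Multiset.coe_card, P.edges_eq]; rfl

theorem Presentation.length_singles : P.singles.length = G.singles.card := by
  rw [← Multiset.coe_card, P.singles_eq]; rfl

theorem Presentation.length_sets : P.sets.length = G.sets.card := by
  rw [← List.length_map (f := Multiset.ofList), ← Multiset.coe_card, P.sets_eq, Multiset.card_map]
  rfl

theorem Presentation.mem_edges (e : V × V) : e ∈ P.edges ↔ e ∈ G.arena.edges := by
  rw [← Multiset.mem_coe, P.edges_eq]; rfl

theorem Presentation.mem_singles (t : V) : t ∈ P.singles ↔ t ∈ G.singles := by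
  rw [← Multiset.mem_coe, P.singles_eq]; rfl

theorem Presentation.countP_singles (p : V → Prop) [DecidablePred p] :
    P.singles.countP p = (G.singles.filter p).card := by
  rw [Finset.card_def, Finset.filter_val, ← P.singles_eq, ← Multiset.countP_eq_card_filter,
    Multiset.coe_countP]

theorem Presentation.exists_set {l : List V} (hl : l ∈ P.sets) :
    ∃ X ∈ G.sets, X.val = Multiset.ofList l := by
  have : Multiset.ofList l ∈ G.sets.val.map Finset.val := by
    rw [← P.sets_eq]; exact Multiset.mem_coe.2 (List.mem_map_of_mem hl)
  exact Multiset.mem_map.1 this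

theorem Presentation.length_le {l : List V} (hl : l ∈ P.sets) : l.length ≤ Fintype.card V := by
  obtain ⟨X, -, hX⟩ := P.exists_set hl
  rw [← Multiset.coe_card, ← hX]
  exact X.card_le_univ

theorem Presentation.forall_sets (D : Set V) :
    (∀ X ∈ G.sets, ∃ u ∈ X, u ∈ D) ↔ ∀ i < G.sets.card, ∃ u ∈ D, P.mem i u := by
  rw [← P.length_sets]
  constructor
  · intro h i hi
    obtain ⟨X, hX, he⟩ := P.exists_set (List.getElem_mem hi)
    obtain ⟨u, hu, hD⟩ := h X hX
    refine ⟨u, hD, ?_⟩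
    rw [Presentation.mem, List.getD_eq_getElem _ _ hi, ← Multiset.mem_coe, ← he]
    exact hu
  · intro h X hX
    have : X.val ∈ Multiset.ofList (P.sets.map Multiset.ofList) := by
      rw [P.sets_eq]; exact Multiset.mem_map_of_mem _ hX
    obtain ⟨l, hl, he⟩ := List.mem_map.1 (Multiset.mem_coe.1 this)
    obtain ⟨i, hi, rfl⟩ := List.getElem_of_mem hl
    obtain ⟨u, hD, hu⟩ := h i hi
    rw [Presentation.mem, List.getD_eq_getElem _ _ hi, ← Multiset.mem_coe, he] at hu
    exact ⟨u, hu, hD⟩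

theorem Presentation.num_inj {v w : V} : (P.num v : ℕ) = P.num w ↔ v = w := by
  rw [← Fin.ext_iff, P.num.injective.eq_iff]

/-- The memory holds the input and the product with the first `j` monitors. -/
structure Presentation.Stage (j : ℕ) (μ : Mem) : Prop extends P.Kept μ where
  product : IsProduct P.num G.levels G.arena (G.lo P.mem) G.hi j μ

variable {P}

theorem Presentation.Stage.same {j : ℕ} {p : Prog} {μ μ' : Mem} (h : P.Stage j μ)
    (hs : Same p μ μ') (hr : ∀ r ∈ [0, 1, 2, 3, 4, 10, 11], r ∉ p.regs)
    (ha : ∀ a ∈ [0, 1, 2, 3, 4, 5, 14], a ∉ p.arrs) : P.Stage j μ' where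
  toKept := h.toKept.same hs (fun r h => hr r (by simp; omega)) fun a h h' => ha a (by simp; omega)
  product := h.product.of_eq (hs.reg _ (hr _ (by simp))) (hs.reg _ (hr _ (by simp)))
    (hs.arr _ (ha _ (by simp))) (hs.arr _ (ha _ (by simp))) (hs.arr _ (ha _ (by simp)))
    (hs.arr _ (ha _ (by simp)))

theorem Presentation.Kept.reg_two {μ : Mem} (h : P.Kept μ) : μ.reg 2 = P.singles.length :=
  h.reg 2 (by omega)

theorem Presentation.Kept.arr_three {μ : Mem} (h : P.Kept μ) {j : ℕ} (hj : j < P.singles.length) :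
    μ.arr 3 j = P.num P.singles[j] := by
  rw [h.arr 3 (by omega) le_rfl]
  simp [Presentation.input, hj]

variable (P)

theorem initProg_runs : Runs initProg P.input (Fintype.card V * 19 + 8) fun μ =>
    P.Stage 0 μ ∧ (∀ v, μ.arr 15 (P.num v) = G.singles.card + 1) ∧ ∀ i, μ.arr 16 i = 0 := by
  refine ((Runs.loop (Fintype.card V) 15 (fun i μ => μ.reg 30 = i ∧ ∀ x < i,
    μ.arr 14 x = x ∧ μ.arr 15 x = G.singles.card + 1) ⟨rfl, by simp⟩ ?_ ?_).seq
      (B' := 4) fun μ hs hI => ?_).mono (by simp [Expr.cost]) fun _ h => h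
  · rintro i hi μ hs ⟨h1, h2⟩
    have r0 : μ.reg 0 = Fintype.card V := hs.reg 0 (by decide)
    have r2 : μ.reg 2 = G.singles.card := (hs.reg 2 (by decide)).trans P.length_singles
    refine ⟨by simp [Expr.eval]; omega, Runs.of_run rfl (by decide) ?_⟩
    simp only [Prog.run, Prog.incr, Expr.eval, Mem.setReg_reg, Mem.setReg_arr, Mem.setArr_reg,
      Mem.setArr_arr, h1, r2, if_true]
    refine ⟨trivial, fun x hx => ?_⟩
    rcases Nat.lt_succ_iff_lt_or_eq.1 hx with hx | rfl
    · simpa [hx.ne] using h2 x hx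
    · simp
  · rintro μ hs ⟨h1, h2⟩
    have r0 : μ.reg 0 = Fintype.card V := hs.reg 0 (by decide)
    simp [Expr.eval]; omega
  · have r0 : μ.reg 0 = Fintype.card V := hs.reg 0 (by decide)
    have r1 : μ.reg 1 = G.arena.edges.card := (hs.reg 1 (by decide)).trans P.length_edges
    have a0 := hs.arr 0 (by decide)
    have a1 := hs.arr 1 (by decide)
    have a2 := hs.arr 2 (by decide)
    refine Runs.of_run rfl (by decide) ⟨⟨⟨fun r hr => ?_, fun a ha ha' => ?_⟩, ?_⟩, fun v => ?_,
      fun i => ?_⟩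
    · rw [← hs.reg r (by revert r; decide)]
      simp [Prog.run, show r ≠ 10 by omega, show r ≠ 11 by omega]
    · rw [← hs.arr a (by revert a; decide)]
      rfl
    · constructor
      · simp [Prog.run, Expr.eval, r0, copies]
      · simp [Prog.run, Expr.eval, r1, copies]
      · intro v q _
        simp [Prog.run, a0, Presentation.input, code]
      · intro v q _
        exact (hI.2 _ (P.num v).2).1
      · intro e he
        have he' : e < P.edges.length := by rw [P.length_edges]; simpa [copies] using he
        refine ⟨P.edges[e].1, P.edges[e].2, fun _ => 0, (P.mem_edges _).1 (List.getElem_mem he'),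
          by simp, ?_, ?_⟩
        · simp [Prog.run, a1, Presentation.input, code, he']
        · simp [Prog.run, a2, Presentation.input, code, he']
      · intro u w q hE _
        obtain ⟨e, he, hee⟩ := List.getElem_of_mem ((P.mem_edges _).2 hE)
        refine ⟨e, by rw [P.length_edges] at he; simpa [copies] using he, ?_, ?_⟩
        · simp [Prog.run, a1, Presentation.input, code, he, hee]
        · simp [Prog.run, a2, Presentation.input, code, he, hee]
    · exact (hI.2 _ (P.num v).2).2
    · change μ.arr 16 i = 0
      rw [hs.arr 16 (by decide)]; rfl

variable {P}

/-- Without monitors the levels play no role, and the interval from `num t` to `num t + 1` contains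
the single vertex `t`. Hence one run of `attrProg` decides `Game.le` towards `t`. -/
theorem attr_code_zero_iff (t t' : V) (q : ℕ → ℕ) :
    Attr (fun x y : V × (ℕ → ℕ) => (x.1, y.1) ∈ G.arena.edges ∧
        y.2 = fun i => jump (G.lo P.mem i x.1) (G.hi i x.1) (x.2 i))
      (fun x => G.arena.owner x.1 = .eve)
      (fun x => (P.num t : ℕ) ≤ code P.num G.levels 0 x.1 x.2 ∧
        code P.num G.levels 0 x.1 x.2 < (P.num t : ℕ) + 1) (t', q) ↔ G.le t' t := by
  refine Attr.bisim_iff (R := fun (x : V × (ℕ → ℕ)) v => x.1 = v) ?_ ?_ ?_ ?_ rfl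
  · rintro x _ rfl
    rw [code, ← P.num_inj]
    omega
  · rintro x _ rfl
    rfl
  · rintro x _ rfl y hE
    exact ⟨y.1, hE.1, rfl⟩
  · rintro x _ rfl w hE
    exact ⟨(w, _), ⟨hE, rfl⟩, rfl⟩

open scoped Classical in
theorem heightProg_runs {μ : Mem} (h : P.Stage 0 μ) :
    Runs heightProg μ (G.singles.card * (G.arena.edges.card * 180 + G.singles.card * 18 + 80) + 6)
      fun μ' => ∀ i (hi : i < P.singles.length), μ'.arr 19 i = G.height P.singles[i] := by
  have hlen := P.length_singles
  refine (((Prog.runs rfl μ).mono (B' := 2) (by decide) fun _ h => h).seq fun μ₁ s₁ h₁ => ?_).mono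
    (B := 2 + (G.singles.card * (G.arena.edges.card * 180 + G.singles.card * 18 + 80) + 4))
    (by omega) fun _ h => h
  have st₁ := h.same s₁ (by decide) (by decide)
  refine (Runs.loop P.singles.length (G.arena.edges.card * 180 + G.singles.card * 18 + 76)
    (fun j μ' => P.Stage 0 μ' ∧ μ'.reg 30 = j ∧ ∀ i (hi : i < P.singles.length), i < j →
      μ'.arr 19 i = G.height P.singles[i]) ⟨st₁, by simp [h₁, Prog.run, Expr.eval], by simp⟩
      ?_ ?_).mono (by simp [Expr.cost, hlen]) fun μ' h i hi => h.2.2 i hi hi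
  · rintro j hj μ₂ - ⟨st₂, r30, hI⟩
    have r2 := st₂.reg_two
    refine ⟨by simp [Expr.eval]; omega, ?_⟩
    refine (((Prog.runs rfl μ₂).mono (B' := 8) (by decide) fun _ h => h).seq
      fun μ₃ s₃ h₃ => ?_).mono (B := 8 + (G.arena.edges.card * 180 + 50 +
        (G.singles.card * 18 + 8 + 10))) (by omega) fun _ h => h
    have st₃ := st₂.same s₃ (by decide) (by decide)
    have a3 := st₂.arr_three hj
    refine ((st₃.product.attrProg_runs Game.hi_lt_levels (a := P.num P.singles[j])
      (b := P.num P.singles[j] + 1) ?_ ?_ ?_).mono (by simp [copies]) fun _ h => h).seq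
        fun μ₄ s₄ h₄ => ?_
    · simp [h₃, Prog.run, Expr.eval, r30, a3]
    · simp [h₃, Prog.run, Expr.eval, r30, a3]
    · rw [copies, mul_one]; exact (P.num P.singles[j]).2
    have st₄ := st₃.same s₄ (by decide) (by decide)
    refine ((countProg_runs P.singles (G.le · P.singles[j]) st₄.reg_two ?_).mono
      (by simp [Expr.cost, hlen]) fun _ h => h).seq fun μ₅ s₅ h₅ => ?_
    · intro μ' s' i hi h31
      have st' := st₄.same s' (by decide) (by decide)
      have := h₄ P.singles[i] (fun _ => 0) (by simp)
      rw [attr_code_zero_iff] at this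
      rw [← this]
      simp only [Expr.eval, h31, st'.arr_three hi, s'.arr 10 (by decide), code]
      omega
    have st₅ := st₄.same s₅ (by decide) (by decide)
    have q30 : μ₅.reg 30 = j := by
      rw [s₅.reg _ (by decide), s₄.reg _ (by decide), s₃.reg _ (by decide), r30]
    have a19 : μ₅.arr 19 = μ₂.arr 19 := by
      rw [s₅.arr _ (by decide), s₄.arr _ (by decide), s₃.arr _ (by decide)]
    refine (((Prog.runs rfl μ₅).mono (by decide) fun _ h => h).same).mono le_rfl ?_
    rintro μ₆ ⟨h₆, s₆⟩
    refine ⟨st₅.same s₆ (by decide) (by decide), by simp [h₆, Prog.run, Prog.incr, Expr.eval, q30],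
      fun i hi hij => ?_⟩
    simp only [h₆, Prog.run, Prog.incr, Expr.eval, Mem.setReg_arr, Mem.setArr_arr, if_true, q30,
      h₅, a19, P.countP_singles]
    rcases Nat.lt_succ_iff_lt_or_eq.1 hij with hij | rfl
    · rw [Function.update_of_ne hij.ne]; exact hI i hi hij
    · rw [Function.update_self]; rfl
  · rintro μ' - ⟨st, r30, -⟩
    simp [Expr.eval, st.reg_two, r30]

open scoped Classical in
theorem chainProg_runs {μ : Mem} (h : P.Stage 0 μ)
    (h19 : ∀ i (hi : i < P.singles.length), μ.arr 19 i = G.height P.singles[i])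
    (h15 : ∀ v, μ.arr 15 (P.num v) = G.singles.card + 1) (h16 : ∀ i, μ.arr 16 i = 0) :
    Runs chainProg μ (G.singles.card * (G.singles.card * 18 + 50) + 6)
      fun μ' => ∀ v, μ'.arr 15 (P.num v) = G.lo P.mem 0 v ∧ μ'.arr 16 (P.num v) = G.hi 0 v := by
  have hlen := P.length_singles
  refine (((Prog.runs rfl μ).mono (B' := 2) (by decide) fun _ h => h).seq fun μ₁ s₁ h₁ => ?_).mono
    (B := 2 + (G.singles.card * (G.singles.card * 18 + 50) + 4)) (by omega) fun _ h => h
  have st₁ := h.same s₁ (by decide) (by decide)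
  refine (Runs.loop P.singles.length (G.singles.card * 18 + 46)
    (fun j μ' => P.Stage 0 μ' ∧ μ'.reg 30 = j ∧
      ∀ v, (μ'.arr 15 (P.num v) =
        if v ∈ P.singles.take j then G.lo P.mem 0 v else G.singles.card + 1) ∧
        μ'.arr 16 (P.num v) = if v ∈ P.singles.take j then G.hi 0 v else 0)
      ⟨st₁, by simp [h₁, Prog.run, Expr.eval], fun v => ?_⟩
      ?_ ?_).mono (by simp [Expr.cost, hlen]) fun μ' h v => ?_
  · simp [h₁, Prog.run, h15, h16]
  · rintro j hj μ₂ s₂ ⟨st₂, r30, hI⟩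
    have r2 := st₂.reg_two
    refine ⟨by simp [Expr.eval]; omega, ?_⟩
    have a19 : μ₂.arr 19 = μ.arr 19 := by
      rw [s₂.arr _ (by decide), s₁.arr _ (by decide)]
    -- The subtraction of heights is nonzero exactly for the singletons of smaller height, so this
    -- count is `lower`.
    refine ((countProg_runs P.singles (G.height · < G.height P.singles[j]) st₂.reg_two ?_).seq
      (B' := 38) fun μ₃ s₃ h₃ => ?_).mono (by simp [Expr.cost, hlen]) fun _ h => h
    · intro μ' s' i hi h31
      simp only [Expr.eval, h31, s'.arr 19 (by decide), s'.reg 30 (by decide), r30, a19, h19 i hi,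
        h19 j hj]
      omega
    have st₃ := st₂.same s₃ (by decide) (by decide)
    have q30 : μ₃.reg 30 = j := (s₃.reg _ (by decide)).trans r30
    have a19' : μ₃.arr 19 j = G.height P.singles[j] := by
      rw [s₃.arr _ (by decide), a19, h19 j hj]
    rw [P.countP_singles] at h₃
    change _ = G.lower _ at h₃
    have hmem := (P.mem_singles _).1 (List.getElem_mem hj)
    refine (Runs.seq (B := 12) (Q := fun μ₄ => μ₄.reg 32 = G.lo P.mem 0 P.singles[j]) ?_
      fun μ₄ s₄ h₄ => ?_).mono (B := 12 + 26) (by omega) fun _ h => h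
    · refine Runs.of_run rfl (by decide) ?_
      by_cases hlt : G.lower P.singles[j] < G.height P.singles[j]
      · rw [G.lo_zero_of_mem P.mem hmem hlt]
        have hne : G.height P.singles[j] - G.lower P.singles[j] ≠ 0 := by omega
        simp only [Prog.run, Expr.eval, q30, a19', h₃]
        rw [if_neg hne, h₃]
      · rw [G.lo_zero_of_not P.mem (fun h => hlt h.2)]
        have hne : G.height P.singles[j] - G.lower P.singles[j] = 0 := by omega
        simp [Prog.run, Expr.eval, q30, a19', h₃, hne, st₃.reg_two, hlen]
    have st₄ := st₃.same s₄ (by decide) (by decide)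
    have g30 : μ₄.reg 30 = j := (s₄.reg _ (by decide)).trans q30
    have b15 : μ₄.arr 15 = μ₂.arr 15 := by rw [s₄.arr _ (by decide), s₃.arr _ (by decide)]
    have b16 : μ₄.arr 16 = μ₂.arr 16 := by rw [s₄.arr _ (by decide), s₃.arr _ (by decide)]
    refine (((Prog.runs rfl μ₄).mono (by decide) fun _ h => h).same).mono le_rfl ?_
    rintro μ₅ ⟨h₅, s₅⟩
    refine ⟨st₄.same s₅ (by decide) (by decide), by simp [h₅, Prog.run, Prog.incr, Expr.eval, g30],
      fun v => ?_⟩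
    have c19 : μ₄.arr 19 j = G.height P.singles[j] := by rw [s₄.arr _ (by decide), a19']
    simp only [h₅, Prog.run, Prog.incr, Expr.eval, Mem.setReg_arr, Mem.setArr_arr, Mem.setArr_reg,
      Nat.reduceEqDiff, if_true, if_false, g30, st₄.arr_three hj, h₄, b15, b16, c19,
      List.take_succ_eq_append_getElem hj, List.mem_append, List.mem_singleton]
    by_cases hv : v = P.singles[j]
    · subst hv
      rw [Function.update_self, Function.update_self, if_pos (.inr rfl), if_pos (.inr rfl),
        Game.hi_zero_of_mem hmem]
      exact ⟨rfl, rfl⟩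
    · have hv' : (P.num v : ℕ) ≠ P.num P.singles[j] := fun h => hv (P.num_inj.1 h)
      rw [Function.update_of_ne hv', Function.update_of_ne hv']
      simp only [hv, or_false]
      exact hI v
  · rintro μ' - ⟨st, r30, -⟩
    simp [Expr.eval, st.reg_two, r30]
  · obtain ⟨h1, h2⟩ := h.2.2 v
    rw [List.take_length] at h1 h2
    rw [h1, h2]
    by_cases hv' : v ∈ P.singles
    · rw [if_pos hv', if_pos hv']
      exact ⟨rfl, rfl⟩
    · have hv : v ∉ G.singles := fun h => hv' ((P.mem_singles v).2 h)
      rw [if_neg hv', if_neg hv', G.lo_zero_of_not P.mem fun h => hv h.1]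
      exact ⟨rfl, (if_neg hv).symm⟩

theorem clearProg_runs {μ : Mem} (h0 : μ.reg 0 = Fintype.card V) :
    Runs clearProg μ (Fintype.card V * 20 + 10) fun μ' =>
      ∀ v : V, ∀ num : V ≃ Fin (Fintype.card V), μ'.arr 15 (num v) = 2 ∧ μ'.arr 16 (num v) = 1 := by
  refine (((Prog.runs rfl μ).mono (B' := 2) (by decide) fun _ h => h).seq fun μ₁ s₁ h₁ => ?_).mono
    (B := 2 + (Fintype.card V * 20 + 4)) (by omega) fun _ h => h
  refine (Runs.loop (Fintype.card V) 16 (fun i μ' => μ'.reg 31 = i ∧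
    ∀ x < i, μ'.arr 15 x = 2 ∧ μ'.arr 16 x = 1) (by simp [h₁, Prog.run, Expr.eval]) ?_ ?_).mono
      (by simp [Expr.cost]) fun μ' h v num => h.2 _ (num v).2
  · rintro i hi μ' hs ⟨h31, hI⟩
    have r0 : μ'.reg 0 = Fintype.card V := by
      rw [hs.reg _ (by decide), s₁.reg _ (by decide), h0]
    refine ⟨by simp [Expr.eval]; omega, Runs.of_run rfl (by decide) ?_⟩
    simp only [Prog.run, Prog.incr, Expr.eval, Mem.setReg_reg, Mem.setReg_arr, Mem.setArr_reg,
      Mem.setArr_arr, h31, Nat.reduceEqDiff, if_true, if_false]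
    refine ⟨trivial, fun x hx => ?_⟩
    rcases Nat.lt_succ_iff_lt_or_eq.1 hx with hx | rfl
    · simpa [hx.ne] using hI x hx
    · simp
  · rintro μ' hs ⟨h31, -⟩
    have r0 : μ'.reg 0 = Fintype.card V := by
      rw [hs.reg _ (by decide), s₁.reg _ (by decide), h0]
    simp [Expr.eval, r0, h31]

open scoped Classical in
theorem markProg_runs {μ : Mem} {j : ℕ} {X : List V} (num : V ≃ Fin (Fintype.card V))
    (h4 : μ.arr 4 j = X.length) (h30 : μ.reg 30 = j)
    (h5 : ∀ i (hi : i < X.length), μ.arr 5 (μ.reg 33 + i) = num X[i])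
    (h15 : ∀ v, μ.arr 15 (num v) = 2) :
    Runs markProg μ (X.length * 20 + 10) fun μ' => μ'.reg 33 = μ.reg 33 + X.length ∧
      ∀ v, μ'.arr 15 (num v) = if v ∈ X then 0 else 2 := by
  refine (((Prog.runs rfl μ).mono (B' := 3) (by decide) fun _ h => h).seq fun μ₁ s₁ h₁ => ?_).mono
    (B := 3 + (X.length * 20 + 7)) (by omega) fun _ h => h
  refine (Runs.loop X.length 18 (fun i μ' => μ'.reg 34 + i = X.length ∧
    μ'.reg 33 = μ.reg 33 + i ∧ ∀ v, μ'.arr 15 (num v) = if v ∈ X.take i then 0 else 2)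
      ⟨by simp [h₁, Prog.run, Expr.eval, h30, h4], by simp [h₁, Prog.run],
        by simp [h₁, Prog.run, h15]⟩ ?_ ?_).mono
      (by simp [Expr.cost]) fun μ' h => ⟨h.2.1, by simpa using h.2.2⟩
  · rintro i hi μ' hs ⟨h34, h33, hI⟩
    have a5 : μ'.arr 5 (μ.reg 33 + i) = num X[i] := by
      rw [hs.arr _ (by decide), s₁.arr _ (by decide), h5 i hi]
    refine ⟨by simp only [Expr.eval]; omega, Runs.of_run rfl (by decide) ?_⟩
    simp only [Prog.run, Prog.incr, Expr.eval, Mem.setReg_reg, Mem.setReg_arr, Mem.setArr_reg,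
      Mem.setArr_arr, h33, a5, Nat.reduceEqDiff, if_true, if_false]
    refine ⟨by omega, by omega, fun v => ?_⟩
    simp only [List.take_succ_eq_append_getElem hi, List.mem_append, List.mem_singleton]
    by_cases hv : v = X[i]
    · subst hv
      rw [Function.update_self, if_pos (.inr rfl)]
    · rw [Function.update_of_ne fun h => hv (num.injective (Fin.ext h)), hI v]
      simp only [hv, or_false]
  · rintro μ' hs ⟨h34, -⟩
    simp only [Expr.eval]; omega

/-- Register 33 is the reading position in array 5. It persists from set to set, and the invariant
says that the array continues there with the concatenation of the remaining sets. The bound stays a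
sum because the products double. -/
theorem setsProg_runs {μ : Mem} (h : P.Stage 1 μ) (h33 : μ.reg 33 = 0) :
    Runs setsProg μ (∑ j ∈ Finset.range G.sets.card, (Fintype.card V * 40 +
      G.arena.edges.card * ((G.singles.card + 1) * 2 ^ (j + 1)) * 300 + 30) + 10)
      (P.Stage (G.sets.card + 1)) := by
  have hlen := P.length_sets
  refine (((Prog.runs rfl μ).mono (B' := 4) (by decide) fun _ h => h).seq fun μ₁ s₁ h₁ => ?_).mono
    (B := 4 + (∑ j ∈ Finset.range G.sets.card, (Fintype.card V * 40 +
      G.arena.edges.card * ((G.singles.card + 1) * 2 ^ (j + 1)) * 300 + 30) + 4))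
    (by omega) fun _ h => h
  have st₁ := h.same s₁ (by decide) (by decide)
  refine (Runs.loop_sum P.sets.length (fun j => Fintype.card V * 40 +
      G.arena.edges.card * ((G.singles.card + 1) * 2 ^ (j + 1)) * 300 + 26)
    (fun j μ' => P.Stage (j + 1) μ' ∧ μ'.reg 30 = j ∧ ∀ i, μ'.arr 5 (μ'.reg 33 + i) =
      ((P.sets.drop j).flatten.map fun v => (P.num v : ℕ)).getD i 0)
      ⟨st₁, by simp [h₁, Prog.run, Expr.eval], fun i => ?_⟩
      ?_ ?_).mono (by simp [Expr.cost, hlen]) fun μ' h => ?_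
  · rw [s₁.reg _ (by decide), h33, zero_add, st₁.arr 5 (by omega) (by omega)]; rfl
  · rintro j hj μ₂ s₂ ⟨st₂, r30, hI⟩
    have r3 : μ₂.reg 3 = P.sets.length := st₂.reg 3 (by omega)
    have r14 : μ₂.reg 14 = 2 := by
      rw [s₂.reg _ (by decide)]; simp [h₁, Prog.run, Expr.eval]
    have hX := P.length_le (List.getElem_mem hj)
    refine ⟨by simp [Expr.eval]; omega, ?_⟩
    refine ((clearProg_runs (V := V) (st₂.reg 0 (by omega))).seq fun μ₃ s₃ h₃ => ?_).mono
      (B := Fintype.card V * 20 + 10 + (Fintype.card V * 20 + 10 + (G.arena.edges.card *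
        ((G.singles.card + 1) * 2 ^ (j + 1)) * 300 + 4))) (by omega) fun _ h => h
    have st₃ := st₂.same s₃ (by decide) (by decide)
    rw [List.drop_eq_getElem_cons hj, List.flatten_cons, List.map_append] at hI
    refine ((markProg_runs (j := j) (X := P.sets[j]) P.num ?_ ?_ ?_ fun v => (h₃ v P.num).1).mono
      (by omega) fun _ h => h).seq fun μ₄ s₄ h₄ => ?_
    · rw [st₃.arr 4 (by omega) (by omega)]
      simp [Presentation.input, hj]
    · rw [s₃.reg _ (by decide), r30]
    · intro i hi
      rw [s₃.arr _ (by decide), s₃.reg _ (by decide), hI, List.getD_append _ _ _ _ (by simpa)]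
      simp [hi]
    have st₄ := st₃.same s₄ (by decide) (by decide)
    refine ((st₄.product.prodProg_runs Game.hi_lt_levels G.start ?_ (fun v => ?_) fun v => ?_).mono
      (by rw [G.copies_levels]) fun _ h => h).seq fun μ₅ s₅ h₅ => ?_
    · rw [s₄.reg _ (by decide), s₃.reg _ (by decide), r14]; rfl
    · rw [h₄.2 v]
      by_cases hv : v ∈ P.sets[j]
      · rw [if_pos hv, G.lo_succ_of_mem]
        rwa [Presentation.mem, List.getD_eq_getElem _ _ hj]
      · rw [if_neg hv, G.lo_succ_of_not]
        rwa [Presentation.mem, List.getD_eq_getElem _ _ hj]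
    · rw [s₄.arr _ (by decide), (h₃ v P.num).2]; rfl
    have st₅ : P.Stage (j + 1 + 1) μ₅ := ⟨st₄.toKept.same s₅ (by decide) (by decide), h₅⟩
    refine (((Prog.runs rfl μ₅).mono (by decide) fun _ h => h).same).mono le_rfl ?_
    rintro μ₆ ⟨h₆, s₆⟩
    refine ⟨st₅.same s₆ (by decide) (by decide), ?_, fun i => ?_⟩
    · simp [h₆, Prog.run, Prog.incr, Expr.eval, s₅.reg 30 (by decide), s₄.reg 30 (by decide),
        s₃.reg 30 (by decide), r30]
    · have := hI (P.sets[j].length + i)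
      rw [List.getD_append_right _ _ _ _ (by simp)] at this
      simp only [List.length_map, Nat.add_sub_cancel_left] at this
      rw [← this, s₆.reg _ (by decide), s₅.reg _ (by decide), h₄.1, s₃.reg _ (by decide),
        s₆.arr _ (by decide), s₅.arr _ (by decide), s₄.arr _ (by decide), s₃.arr _ (by decide),
        add_assoc]
  · rintro μ' - ⟨st, r30, -⟩
    have r3 : μ'.reg 3 = P.sets.length := st.reg 3 (by omega)
    simp [Expr.eval, r3, r30]
  · rw [← hlen]; exact h.1

theorem code_zero_levels {V : Type*} [Fintype V] (num : V ≃ Fin (Fintype.card V)) (L : ℕ → ℕ)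
    (j : ℕ) (v : V) : code num L j v (fun _ => 0) = num v := by
  induction j with
  | zero => rfl
  | succ j ih => rw [code, ih, zero_mul, add_zero]

/-- By `le_code_iff` the positions with all monitors at their last levels fill the last `|V|`
numbers. At levels 0 the start vertex keeps its input number, still in register 4. -/
theorem finalProg_runs {μ : Mem} (h : P.Stage (G.sets.card + 1) μ) :
    Runs finalProg μ (G.arena.edges.card * ((G.singles.card + 1) * 2 ^ G.sets.card) * 180 + 70)
      fun μ' => μ'.reg 0 = 1 ↔ G.EveWins := by
  have r0 : μ.reg 0 = Fintype.card V := h.reg 0 (by omega)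
  have hL : ∀ i, 0 < G.levels i := fun i => (Nat.zero_le _).trans_lt (G.hi_lt_levels i G.start)
  refine (((Prog.runs rfl μ).mono (B' := 6) (by decide) fun _ h => h).seq fun μ₁ s₁ h₁ => ?_).mono
    (B := 6 + (G.arena.edges.card * ((G.singles.card + 1) * 2 ^ G.sets.card) * 180 + 50 + 6))
    (by omega) fun _ h => h
  have st₁ := h.same s₁ (by decide) (by decide)
  have h10 := h.product.vertices
  refine ((st₁.product.attrProg_runs Game.hi_lt_levels
    (a := Fintype.card V * copies G.levels (G.sets.card + 1) - Fintype.card V)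
    (b := Fintype.card V * copies G.levels (G.sets.card + 1)) ?_ ?_ le_rfl).mono
      (by rw [G.copies_levels]) fun _ h => h).seq fun μ₂ s₂ h₂ => ?_
  · simp [h₁, Prog.run, Expr.eval, h10, r0]
  · simp [h₁, Prog.run, Expr.eval, h10]
  have st₂ := st₁.same s₂ (by decide) (by decide)
  have r4 : μ₂.reg 4 = P.num G.start := st₂.reg 4 (by omega)
  have h₂ := h₂ G.start (fun _ => 0) fun i _ => hL i
  refine Runs.of_run rfl (by decide) ?_
  have hb := h₂.trans (Attr.bisim_iff (eve' := fun x => G.arena.owner x.1 = .eve)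
    (E' := fun x y => (x.1, y.1) ∈ G.arena.edges ∧
      y.2 = fun i => jump (G.lo P.mem i x.1) (G.hi i x.1) (x.2 i))
    (T' := fun x => ∀ i ≤ G.sets.card, x.2 i + 1 = G.levels i)
    (R := fun (x y : V × (ℕ → ℕ)) => x = y ∧ ∀ i < G.sets.card + 1, x.2 i < G.levels i)
    ?_ ?_ ?_ ?_ ⟨rfl, fun i _ => hL i⟩)
  · rw [code_zero_levels] at hb
    refine Iff.trans ?_ (hb.trans (G.eveWins_iff_monitorWins P.forall_sets).symm)
    simp only [Prog.run, Expr.eval, r4, Mem.setReg_reg, if_true]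
    omega
  · rintro x _ ⟨rfl, hx⟩
    rw [le_code_iff hL hx]
    simp only [code_lt hx, and_true, Nat.lt_succ_iff]
  · rintro x _ ⟨rfl, hx⟩
    rfl
  · rintro x _ ⟨rfl, hx⟩ y hE
    exact ⟨y, hE, rfl, fun i hi => by rw [hE.2]; exact jump_lt (G.hi_lt_levels i _) (hx i hi)⟩
  · rintro x _ ⟨rfl, hx⟩ y hE
    exact ⟨y, hE, rfl, fun i hi => by rw [hE.2]; exact jump_lt (G.hi_lt_levels i _) (hx i hi)⟩

/-- A bound for the sum of the running times of the parts of the program. -/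
theorem time_le {v m n k : ℕ} (hv : 0 < v) (hvm : v ≤ m) (hnv : n ≤ v) :
    v * 19 + 8 + (n * (m * 180 + n * 18 + 80) + 6 + (n * (n * 18 + 50) + 6 + (4 +
      (m * (n + 1) * 300 + (∑ j ∈ Finset.range k, (v * 40 +
        m * ((n + 1) * 2 ^ (j + 1)) * 300 + 30) + 10 +
          (m * ((n + 1) * 2 ^ k) * 180 + 70)))))) ≤ 4000 * (m * max n 1 * 2 ^ k) := by
  -- With `b` for m · max(n, 1), every summand is at most a multiple of `b * 2 ^ k`, and the claim
  -- becomes linear.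
  obtain ⟨b, hb⟩ : ∃ b, b = m * max n 1 := ⟨_, rfl⟩
  have hmb : m ≤ b := hb ▸ Nat.le_mul_of_pos_right _ (by omega)
  have hnb : n * m ≤ b := by rw [hb, mul_comm]; exact Nat.mul_le_mul_left _ (le_max_left _ _)
  have hnn : n * n ≤ b := (Nat.mul_le_mul_left n (hnv.trans hvm)).trans hnb
  have h2b : m * (n + 1) ≤ 2 * b := by rw [mul_add, mul_comm m n]; omega
  have hk : k ≤ 2 ^ k := Nat.lt_two_pow_self.le
  -- The products give a geometric sum; clearing and marking cost at most `70 * b` per set, absorbed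
  -- by `k ≤ 2 ^ k`.
  have hsum : ∑ j ∈ Finset.range k, (v * 40 + m * ((n + 1) * 2 ^ (j + 1)) * 300 + 30) ≤
      b * 2 ^ k * 1270 := by
    calc _ ≤ ∑ j ∈ Finset.range k, (b * 70 + b * 1200 * 2 ^ j) := by
          refine Finset.sum_le_sum fun j _ => ?_
          have := Nat.mul_le_mul_right (2 ^ j) h2b
          rw [pow_succ, show m * ((n + 1) * (2 ^ j * 2)) = m * (n + 1) * 2 ^ j * 2 by ring,
            show b * 1200 * 2 ^ j = 2 * b * 2 ^ j * 600 by ring]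
          omega
      _ = k * (b * 70) + b * 1200 * (2 ^ k - 1) := by
          rw [Finset.sum_add_distrib, ← Finset.mul_sum (f := (2 ^ ·)), Nat.geomSum_eq le_rfl]
          simp
      _ ≤ 2 ^ k * (b * 70) + b * 1200 * 2 ^ k :=
          Nat.add_le_add (Nat.mul_le_mul_right _ hk) (Nat.mul_le_mul_left _ (Nat.sub_le _ _))
      _ = _ := by ring
  have hlast : m * ((n + 1) * 2 ^ k) ≤ 2 * (b * 2 ^ k) := by
    have := Nat.mul_le_mul_right (2 ^ k) h2b
    rw [← mul_assoc, ← mul_assoc]; exact this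
  have hbk : b ≤ b * 2 ^ k := Nat.le_mul_of_pos_right _ (by positivity)
  rw [← hb]
  have e1 : n * (m * 180 + n * 18 + 80) = n * m * 180 + n * n * 18 + n * 80 := by ring
  have e2 : n * (n * 18 + 50) = n * n * 18 + n * 50 := by ring
  rw [e1, e2]
  omega

theorem solveProg_solves (G : Game V) : SolvesWithin solveProg G
    (4000 * (G.arena.edges.card * max G.singles.card 1 * 2 ^ G.sets.card)) := by
  intro P
  have hV : 0 < Fintype.card V := Fintype.card_pos_iff.2 ⟨G.start⟩
  suffices H : Runs solveProg P.input _ fun μ => μ.reg 0 = 1 ↔ G.EveWins from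
    H.mono (time_le (k := G.sets.card) hV G.arena.card_le_card_edges G.singles.card_le_univ)
      fun _ h => h
  refine (initProg_runs P).seq fun μ₁ s₁ ⟨st₁, h15, h16⟩ => ?_
  refine (heightProg_runs st₁).seq fun μ₂ s₂ h19 => ?_
  have st₂ := st₁.same s₂ (by decide) (by decide)
  refine (chainProg_runs st₂ h19 (by rwa [s₂.arr _ (by decide)])
    (by rwa [s₂.arr _ (by decide)])).seq fun μ₃ s₃ h₃ => ?_
  have st₃ := st₂.same s₃ (by decide) (by decide)
  refine ((Prog.runs rfl μ₃).mono (by decide) fun _ h => h).seq fun μ₄ s₄ h₄ => ?_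
  have st₄ := st₃.same s₄ (by decide) (by decide)
  have r2 : μ₃.reg 2 = G.singles.card := st₃.reg_two.trans P.length_singles
  refine ((st₄.product.prodProg_runs Game.hi_lt_levels G.start ?_ (fun v => ?_) fun v => ?_).mono
    (by rw [G.copies_levels]; simp) fun _ h => h).seq fun μ₅ s₅ h₅ => ?_
  · simp [h₄, Prog.run, Expr.eval, r2]; rfl
  · rw [s₄.arr _ (by decide), (h₃ v).1]
  · rw [s₄.arr _ (by decide), (h₃ v).2]
  have st₅ : P.Stage 1 μ₅ := ⟨st₄.toKept.same s₅ (by decide) (by decide), h₅⟩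
  refine (setsProg_runs st₅ ?_).seq fun μ₆ s₆ st₆ => finalProg_runs st₆
  rw [s₅.reg _ (by decide), s₄.reg _ (by decide), s₃.reg _ (by decide), s₂.reg _ (by decide),
    s₁.reg _ (by decide)]
  rfl

end Presentation

/-- Both factors are at most the size, the second because there is a vertex; this gives the exponent
2. -/
theorem Game.edges_mul_singles_le {V : Type*} [Fintype V] (G : Game V) :
    G.arena.edges.card * max G.singles.card 1 ≤ G.size ^ 2 := by
  have hV : 0 < Fintype.card V := Fintype.card_pos_iff.2 ⟨G.start⟩
  rw [pow_two]
  exact Nat.mul_le_mul (by unfold Game.size; omega) (by unfold Game.size; omega)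

theorem computable_mul_two_pow (C : ℕ) : Computable fun k : ℕ => C * 2 ^ k := by
  have hpow : Primrec₂ ((· ^ ·) : ℕ → ℕ → ℕ) := Primrec₂.unpaired'.1 Nat.Primrec.pow
  exact (Primrec.nat_mul.comp (.const C) (hpow.comp (.const 2) .id)).to_comp

end GenReach

theorem mainTheorem1 :
    (∃ (p : GenReach.Prog) (C : ℕ), ∀ (V : Type*) [Fintype V] (G : GenReach.Game V),
      GenReach.SolvesWithin p G
        (C * (G.arena.edges.card * max G.singles.card 1 * 2 ^ G.sets.card))) ∧
    (∃ (p : GenReach.Prog) (f : ℕ → ℕ) (d : ℕ), Computable f ∧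
      ∀ (V : Type*) [Fintype V] (G : GenReach.Game V),
        GenReach.SolvesWithin p G (f G.sets.card * G.size ^ d)) := by
  refine ⟨⟨GenReach.solveProg, 4000, fun V _ G => GenReach.solveProg_solves G⟩,
    GenReach.solveProg, fun k => 4000 * 2 ^ k, 2, GenReach.computable_mul_two_pow 4000,
    fun V _ G P => ?_⟩
  obtain ⟨t, ht, h⟩ := GenReach.solveProg_solves G P
  refine ⟨t, ht.trans ?_, h⟩
  rw [mul_assoc 4000, mul_comm (2 ^ _)]
  exact Nat.mul_le_mul_left _ (Nat.mul_le_mul_right _ G.edges_mul_singles_le)
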